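/- Notation. Let $\Omega\subset\mathbb{R}^2$ be open and simply connected (in particular connected) with the origin $O\in\Omega$; let $B_r$ be the open ball of radius $r$ about $O$, $e_1,e_2$ the standard basis, and $\operatorname{Sym}$ the space of symmetric real $2\times2$ matrices. For a vector field $f$ put $\operatorname{curl} f=\partial_1f_2-\partial_2f_1$; for a tensor field $F$ let $\operatorname{curl}F$ be the vector field whose $i$-th component is the curl of the $i$-th row, $(\operatorname{curl}F)_i=\partial_1F_{i2}-\partial_2F_{i1}$. $\operatorname{Curl}$ denotes the same operators on (vector- or tensor-valued) distributions, with distributional derivatives. For $v,c\in\mathbb{R}^2$, where $c$ is the curl of a planar tensor field, $v\times c$ denotes the matrix $(v_2e_1-v_1e_2)\otimes c$ (that is, $(v\times e_3)\otimes c$ with the usual cross product in $\mathbb{R}^3$), and for a tensor field $M$, $\int_{\partial B_\epsilon}M\,dy$ is the vector with components $\int_{\partial B_\epsilon}\sum_jM_{ij}\,dy_j$ (the circle run through once, counterclockwise). $\mathcal{A}(\Omega,\operatorname{Sym})$ is the space of $\operatorname{Sym}$-valued distributions on $\Omega$ (componentwise distributions $E_{ij}=E_{ji}\in\mathcal{D}'(\Omega)$)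 whose singular support is contained in $\{O\}$. Scaling degree. For a distribution $T$ on $\Omega-O$ and $\varphi\in\mathcal{D}(B_r-O)$, $B_r\subset\Omega$, $0<\lambda<1$, let $T_\lambda(\varphi)=T(\varphi_\lambda)$ with $\varphi_\lambda(x)=\lambda^{-2}\varphi(x/\lambda)$. The scaling degree of $T$ is the infimum of the $k\in\mathbb{R}$ such that $\lim_{\lambda\to0^+}\lambda^kT_\lambda(\varphi)=0$ for all $\varphi\in\mathcal{D}(B_r-O)$ (for a tensor-valued $T$: for all components; the choice of $r$ is immaterial). It is called finite if such a $k$ exists (the value $-\infty$ is allowed). The scaling degree of a smooth map on $\Omega-O$ is that of the distribution it defines on $\Omega-O$. Statement. Let $E_0:\Omega-O\to\operatorname{Sym}$ be a smooth map of finite scaling degree, and let $\epsilon>0$ be such that the closed ball $\overline{B_\epsilon}$ is contained in $\Omega$. Then there exists $E\in\mathcal{A}(\Omega,\operatorname{Sym})$ with $E|_{\Omega-O}=E_0$ and $\operatorname{Curl}\operatorname{Curl}E=0$ if and only if $$\operatorname{curl}\operatorname{curl}E_0=0\ \text{ in }\Omega-O\qquad\text{and}\qquad\int_{\partial B_\epsilon}\{E_0(y)+(y-x)\times\operatorname{curl}E_0(y)\}\,dy=0\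 \text{ for all }x\in\Omega-O.$$ -/

import Mathlib

open TopologicalSpace MeasureTheory Filter Topology Metric Set
open scoped Distributions LineDeriv ContDiff

noncomputable section

namespace SingularStrain

/-- The Euclidean plane `ℝ²`. -/
abbrev Plane : Type := EuclideanSpace ℝ (Fin 2)

/-- The standard orthonormal basis of the plane (indexed by `0, 1`). -/
def e (i : Fin 2) : Plane := EuclideanSpace.single i 1

/-- The punctured domain `Ω - O`, where `O` is the origin. -/
def punctured (Ω : Opens Plane) : Opens Plane :=
  ⟨(Ω : Set Plane) \ {0}, Ω.isOpen.sdiff isClosed_singleton⟩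

/-- The open ball `B_r` centred at the origin. -/
def openBall (r : ℝ) : Opens Plane := ⟨ball 0 r, isOpen_ball⟩

/-! ### Distributions: restriction, regular distributions, singular support -/

/-- The restriction `T|_U` of `T ∈ 𝓓'(Ω)` to an open set `U ⊆ Ω`: test functions on `U` are
extended by zero to `Ω`. (Only used for `U ⊆ Ω`.) -/
def restrictTo {Ω : Opens Plane} (T : 𝓓'(Ω, ℝ)) (U : Opens Plane) : 𝓓'(U, ℝ) :=
  (TestFunction.monoCLM ℝ : 𝓓(U, ℝ) →L[ℝ] 𝓓(Ω, ℝ)).precompCompactConvergenceCLM ℝ T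

/-- The distribution `ψ ↦ ∫_U f ψ dx` attached to a function `f` that is locally integrable
on `U`. -/
def regular (U : Opens Plane) (f : Plane → ℝ) : 𝓓'(U, ℝ) :=
  ContinuousLinearMap.toUniformConvergenceCLM _ _ _
    (TestFunction.integralAgainstBilinCLM (ContinuousLinearMap.mul ℝ ℝ) volume f :
      𝓓(U, ℝ) →L[ℝ] ℝ)

/-- A distribution on `U` is smooth if it is given by a smooth function on `U`. -/
def IsSmooth {U : Opens Plane} (T : 𝓓'(U, ℝ)) : Prop :=
  ∃ f : Plane → ℝ, ContDiffOn ℝ ∞ f U ∧ T = regular U f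

/-- `T` is smooth at `x` if its restriction to some open neighbourhood of `x` is smooth. -/
def IsSmoothAt {Ω : Opens Plane} (T : 𝓓'(Ω, ℝ)) (x : Plane) : Prop :=
  ∃ U : Opens Plane, U ≤ Ω ∧ x ∈ U ∧ IsSmooth (restrictTo T U)

/-- The singular support of `T`: the closure, in `Ω`, of the set of points of `Ω` at which `T` is
not smooth. -/
def singSupp {Ω : Opens Plane} (T : 𝓓'(Ω, ℝ)) : Set Plane :=
  (Ω : Set Plane) ∩ closure {x | x ∈ Ω ∧ ¬ IsSmoothAt T x}

/-- `Lin`-valued distributions, given by their components `T i j`. -/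
abbrev TensorDistribution (Ω : Opens Plane) : Type := Matrix (Fin 2) (Fin 2) 𝓓'(Ω, ℝ)

/-- `𝒜(Ω, Sym)`: the `Sym`-valued distributions on `Ω` with singular support contained
in `{O}`. -/
def SymA (Ω : Opens Plane) : Set (TensorDistribution Ω) :=
  {E | E.IsSymm ∧ ∀ i j, singSupp (E i j) ⊆ {0}}

/-- The `Lin`-valued distribution on `U` defined by a tensor-valued function. -/
def regularTensor (U : Opens Plane) (f : Plane → Matrix (Fin 2) (Fin 2) ℝ) :
    TensorDistribution U :=
  Matrix.of fun i j => regular U fun x => f x i j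

/-- `E` on `Ω` is an extension of `T₀` on `Ω - O`, i.e. `E|_{Ω - O} = T₀`. -/
def IsExtension {Ω : Opens Plane} (E : TensorDistribution Ω)
    (T₀ : TensorDistribution (punctured Ω)) : Prop :=
  ∀ i j, restrictTo (E i j) (punctured Ω) = T₀ i j

/-! ### Distributional and pointwise curl -/

/-- `Curl v = ∂₁ v₂ - ∂₂ v₁` for a vector-valued distribution. -/
def distCurl {Ω : Opens Plane} (v : Fin 2 → 𝓓'(Ω, ℝ)) : 𝓓'(Ω, ℝ) :=
  ∂_{e 0} (v 1) - ∂_{e 1} (v 0)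

/-- `Curl V` for a tensor-valued distribution, `⟨Curl V, a⟩ = Curl (Vᵀ a)`: the curl is taken
row by row. -/
def distCurlTensor {Ω : Opens Plane} (V : TensorDistribution Ω) : Fin 2 → 𝓓'(Ω, ℝ) :=
  fun i => distCurl fun j => V i j

/-- `curl f = ∂f₂/∂x₁ - ∂f₁/∂x₂` for a vector-valued function. -/
def curl (f : Plane → Fin 2 → ℝ) (x : Plane) : ℝ :=
  fderiv ℝ (fun y => f y 1) x (e 0) - fderiv ℝ (fun y => f y 0) x (e 1)

/-- `curl F` for a tensor-valued function, taken row by row. -/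
def curlTensor (F : Plane → Matrix (Fin 2) (Fin 2) ℝ) (x : Plane) : Fin 2 → ℝ :=
  fun i => curl (fun y j => F y i j) x

/-! ### Scaling degree at the origin -/

/-- The rescaled test function `φ_s(x) = s⁻² φ(x / s)` on `B_r - O`, for `0 < s < 1`
(and `0` for other `s`). -/
def rescale {r : ℝ} (s : ℝ) (φ : 𝓓(punctured (openBall r), ℝ)) :
    𝓓(punctured (openBall r), ℝ) := by
  classical
  exact if h : 0 < s ∧ s < 1 then
    { toFun := fun x => (s ^ 2)⁻¹ * φ (s⁻¹ • x)
      contDiff' := contDiff_const.mul (φ.contDiff.comp (contDiff_const_smul _))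
      hasCompactSupport' :=
        (φ.hasCompactSupport.comp_smul (inv_ne_zero h.1.ne')).mul_left
      tsupport_subset' := by
        intro x hx
        have hx' : s⁻¹ • x ∈ tsupport φ := by
          have h1 : x ∈ tsupport (fun y : Plane => φ (s⁻¹ • y)) :=
            (tsupport_mul_subset_right (f := fun _ : Plane => (s ^ 2)⁻¹)) hx
          exact tsupport_comp_subset_preimage φ (continuous_const_smul s⁻¹) h1
        have hm := φ.tsupport_subset hx'
        have hb : ‖s⁻¹ • x‖ < r := mem_ball_zero_iff.1 hm.1
        have hne : s⁻¹ • x ≠ 0 := hm.2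
        refine ⟨mem_ball_zero_iff.2 ?_, fun h0 => hne ?_⟩
        · have hxe : x = s • (s⁻¹ • x) := (smul_inv_smul₀ h.1.ne' x).symm
          rw [hxe, norm_smul, Real.norm_of_nonneg h.1.le]
          nlinarith [norm_nonneg (s⁻¹ • x), h.1, h.2]
        · rw [mem_singleton_iff.1 h0, smul_zero] }
  else 0

/-- `lim_{s → 0⁺} s^k (T|_{B_r - O})_s = 0` in the sense of distributions on `B_r - O`, where
`T_s(φ) = T(φ_s)`. -/
def ScalesToZero {Ω : Opens Plane} (T : 𝓓'(punctured Ω, ℝ)) (r k : ℝ) : Prop :=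
  ∀ φ : 𝓓(punctured (openBall r), ℝ),
    Tendsto (fun s : ℝ => s ^ k * restrictTo T (punctured (openBall r)) (rescale s φ))
      (𝓝[>] 0) (𝓝 0)

/-- The scaling degree at the origin of a tensor-valued distribution on `Ω - O`: the infimum of
the real `k` with `lim_{s → 0⁺} s^k T_s = 0` on a punctured ball `B_r - O` with `B_r ⊆ Ω`
(the choice of the ball does not matter). It is `⊤` when there is no such `k`. -/
def scalingDegree {Ω : Opens Plane} (T : TensorDistribution (punctured Ω)) : EReal :=
  sInf ((fun k : ℝ => (k : EReal)) ''
    {k | ∃ r : ℝ, 0 < r ∧ openBall r ≤ Ω ∧ ∀ i j, ScalesToZero (T i j) r k})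

/-! ### The Cesàro loop integral -/

/-- The point `(ε cos t, ε sin t)` of the circle `∂B_ε`. -/
def circlePt (ε t : ℝ) : Plane := !₂[ε * Real.cos t, ε * Real.sin t]

/-- The line integral `∫_{∂B_ε} M(y) dy` of a tensor field, a vector with components
`∫_{∂B_ε} ∑ j, M i j dy_j`; the circle is run through once, counterclockwise. -/
def loopIntegral (ε : ℝ) (M : Plane → Matrix (Fin 2) (Fin 2) ℝ) : Fin 2 → ℝ :=
  fun i => ∫ t in (0 : ℝ)..(2 * Real.pi),
    (M (circlePt ε t) i 0 * (-(ε * Real.sin t)) + M (circlePt ε t) i 1 * (ε * Real.cos t))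

/-- `v × c` for a planar vector `v` and the curl `c` of a planar tensor field, i.e. the tensor
`v × (e₃ ⊗ c) = (v × e₃) ⊗ c` with `v × e₃ = v₂ e₁ - v₁ e₂`. -/
def crossCurl (v : Plane) (c : Fin 2 → ℝ) : Matrix (Fin 2) (Fin 2) ℝ :=
  Matrix.vecMulVec ![v 1, -(v 0)] c

/-- The integrand `E₀(y) + (y - x) × curl E₀(y)` of the Cesàro integral. -/
def cesaroIntegrand (E₀ : Plane → Matrix (Fin 2) (Fin 2) ℝ) (x y : Plane) :
    Matrix (Fin 2) (Fin 2) ℝ :=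
  E₀ y + crossCurl (y - x) (curlTensor E₀ y)

end SingularStrain

end

/-! Write Inc E for Curl Curl E. Pairing Inc E with φ means pairing E with second derivatives of φ.
Test on φ = ℓχ, with ℓ affine and χ a cutoff equal to 1 near O: ℓ has no second derivatives, so
those of φ live where ∇χ ≠ 0, away from O, and the value depends on E₀ alone. If curl curl E₀ = 0,
this value is the integral of dχ ∧ f for the closed field f = `cesaroField`, and Green's theorem on
an annulus makes it minus the circulation of f along ∂B_ε. For ℓ(y) = y_i - x_i that circulation is,
up to sign, a component of the Cesàro integral. Hence the loop condition says exactly that Inc E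
annihilates every ℓχ, for any extension E of E₀ (`distCurl_distCurlTensor_cutoff_aff`,
`forall_loopIntegral_eq_zero_iff`). Necessity follows at once.

For sufficiency, finite scaling degree yields some symmetric extension E of finite order near O
(`exists_extension_of_scalesToZero`): uniform boundedness makes the scaling estimate uniform on an
annulus, a dyadic decomposition sums it up to O, and Hahn–Banach extends the functional. Since curl
curl E₀ = 0, Inc E is supported at O, and finite order makes it depend only on a finite jet at O
(`FiniteOrderAtZero.exists_order`). As it annihilates affine functions, it is a finite combination
of functionals φ ↦ ∂^α ∂_i ∂_j φ(0), and each of these is Inc of a symmetric tensor supported at O.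
So Inc E = Inc G with G supported at O (`exists_symm_distCurl_distCurlTensor_eq`), and E - G is the
required extension. -/

namespace SingularStrain

/-! ### Test functions, regular distributions and restrictions -/

/-- A smooth function with compact support in `Ω`, as a test function on `Ω`. -/
noncomputable def mkTest {Ω : Opens Plane} (f : Plane → ℝ) (hf : ContDiff ℝ ∞ f)
    (hc : HasCompactSupport f) (hs : tsupport f ⊆ Ω) : 𝓓(Ω, ℝ) :=
  ⟨f, hf, hc, hs⟩

theorem smooth {Ω : Opens Plane} (φ : 𝓓(Ω, ℝ)) : ContDiff ℝ ∞ φ := φ.contDiff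

theorem lineDerivOp_test_apply {Ω : Opens Plane} (φ : 𝓓(Ω, ℝ)) (v x : Plane) :
    (∂_{v} φ : 𝓓(Ω, ℝ)) x = fderiv ℝ φ x v := by
  rw [TestFunction.lineDerivOp_eq_lineDerivCLM ℝ, TestFunction.lineDerivCLM_eq_fderivCLM,
    TestFunction.fderivCLM_apply_of_le _ (by simp)]

theorem coe_lineDerivOp_test {Ω : Opens Plane} (φ : 𝓓(Ω, ℝ)) (v : Plane) :
    ⇑(∂_{v} φ : 𝓓(Ω, ℝ)) = fun x => fderiv ℝ φ x v :=
  funext fun x => lineDerivOp_test_apply φ v x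

theorem tsupport_lineDerivOp_subset {Ω : Opens Plane} (φ : 𝓓(Ω, ℝ)) (v : Plane) :
    tsupport (∂_{v} φ : 𝓓(Ω, ℝ)) ⊆ tsupport φ := by
  rw [coe_lineDerivOp_test]
  exact tsupport_fderiv_apply_subset ℝ v

theorem lineDerivOp_test_comm {Ω : Opens Plane} (φ : 𝓓(Ω, ℝ)) (v w : Plane) :
    ∂_{v} (∂_{w} φ) = ∂_{w} (∂_{v} φ) := by
  ext x
  have hd : DifferentiableAt ℝ (fderiv ℝ φ) x :=
    ((smooth φ).fderiv_right (m := ∞) (by simp)).differentiable (by simp) x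
  have h := (smooth φ).contDiffAt (x := x) |>.isSymmSndFDerivAt (by simpa using ENat.LEInfty.out)
  rw [lineDerivOp_test_apply, lineDerivOp_test_apply, coe_lineDerivOp_test, coe_lineDerivOp_test,
    fderiv_clm_apply hd (differentiableAt_const _), fderiv_clm_apply hd (differentiableAt_const _)]
  simpa using h.eq v w

theorem monoCLM_test_apply {U Ω : Opens Plane} (h : U ≤ Ω) (φ : 𝓓(U, ℝ)) (x : Plane) :
    (TestFunction.monoCLM ℝ φ : 𝓓(Ω, ℝ)) x = φ x := by
  simp [h]

theorem coe_monoCLM_test {U Ω : Opens Plane} (h : U ≤ Ω) (φ : 𝓓(U, ℝ)) :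
    ⇑(TestFunction.monoCLM ℝ φ : 𝓓(Ω, ℝ)) = φ :=
  funext fun x => monoCLM_test_apply h φ x

theorem lineDerivOp_monoCLM {U Ω : Opens Plane} (h : U ≤ Ω) (φ : 𝓓(U, ℝ)) (v : Plane) :
    ∂_{v} (TestFunction.monoCLM ℝ φ : 𝓓(Ω, ℝ)) = TestFunction.monoCLM ℝ (∂_{v} φ) := by
  ext x
  rw [monoCLM_test_apply h, lineDerivOp_test_apply, lineDerivOp_test_apply, coe_monoCLM_test h]

theorem restrictTo_apply {U Ω : Opens Plane} (T : 𝓓'(Ω, ℝ)) (φ : 𝓓(U, ℝ)) :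
    restrictTo T U φ = T (TestFunction.monoCLM ℝ φ) := rfl

theorem restrictTo_lineDerivOp {U Ω : Opens Plane} (h : U ≤ Ω) (T : 𝓓'(Ω, ℝ)) (v : Plane) :
    restrictTo (∂_{v} T) U = ∂_{v} (restrictTo T U) := by
  ext φ
  rw [restrictTo_apply, Distribution.lineDerivOp_apply_apply, Distribution.lineDerivOp_apply_apply,
    restrictTo_apply, map_neg, map_neg, map_neg, lineDerivOp_monoCLM h]

theorem restrictTo_sub {U Ω : Opens Plane} (T S : 𝓓'(Ω, ℝ)) :
    restrictTo (T - S) U = restrictTo T U - restrictTo S U := rfl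

theorem restrictTo_distCurl_distCurlTensor {U Ω : Opens Plane} (h : U ≤ Ω)
    (E : TensorDistribution Ω) :
    restrictTo (distCurl (distCurlTensor E)) U =
      distCurl (distCurlTensor (fun i j => restrictTo (E i j) U)) := by
  simp only [distCurl, distCurlTensor, restrictTo_sub, restrictTo_lineDerivOp h]

theorem distCurl_distCurlTensor_apply {Ω : Opens Plane} (E : TensorDistribution Ω) (φ : 𝓓(Ω, ℝ)) :
    distCurl (distCurlTensor E) φ =
      E 1 1 (∂_{e 0} (∂_{e 0} φ)) - E 1 0 (∂_{e 1} (∂_{e 0} φ)) -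
        E 0 1 (∂_{e 0} (∂_{e 1} φ)) + E 0 0 (∂_{e 1} (∂_{e 1} φ)) := by
  have h (T S : 𝓓'(Ω, ℝ)) (φ : 𝓓(Ω, ℝ)) : (T - S) φ = T φ - S φ := rfl
  simp only [distCurl, distCurlTensor, h, Distribution.lineDerivOp_apply_apply, map_neg]
  ring

theorem regular_apply {U : Opens Plane} {f : Plane → ℝ} (hf : LocallyIntegrableOn f U volume)
    (φ : 𝓓(U, ℝ)) : regular U f φ = ∫ x, φ x * f x :=
  TestFunction.integralAgainstBilinCLM_eq_integral hf

theorem locallyIntegrableOn_of_contDiffOn {U : Opens Plane} {f : Plane → ℝ}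
    (hf : ContDiffOn ℝ ∞ f U) : LocallyIntegrableOn f U volume :=
  hf.continuousOn.locallyIntegrableOn U.isOpen.measurableSet

theorem regular_apply_of_contDiffOn {U : Opens Plane} {f : Plane → ℝ} (hf : ContDiffOn ℝ ∞ f U)
    (φ : 𝓓(U, ℝ)) : regular U f φ = ∫ x, φ x * f x :=
  regular_apply (locallyIntegrableOn_of_contDiffOn hf) φ

theorem regular_congr {U : Opens Plane} {f g : Plane → ℝ} (hf : ContDiffOn ℝ ∞ f U)
    (h : EqOn f g U) : regular U f = regular U g := by
  have hg : ContDiffOn ℝ ∞ g U := hf.congr fun x hx => (h hx).symm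
  ext φ
  rw [regular_apply_of_contDiffOn hf, regular_apply_of_contDiffOn hg]
  refine integral_congr_ae (Eventually.of_forall fun x => ?_)
  by_cases hx : x ∈ tsupport φ
  · simp only [h (φ.tsupport_subset hx)]
  · simp [image_eq_zero_of_notMem_tsupport hx]

theorem punctured_le (Ω : Opens Plane) : punctured Ω ≤ Ω := fun _ hx => hx.1

/-- A test function on `Ω` whose support avoids the origin, as a test function on `Ω - O`. -/
noncomputable def toPunctured {Ω : Opens Plane} (φ : 𝓓(Ω, ℝ)) (h : (0 : Plane) ∉ tsupport φ) :
    𝓓(punctured Ω, ℝ) :=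
  mkTest φ (smooth φ) φ.hasCompactSupport fun _ hx =>
    ⟨φ.tsupport_subset hx, fun h0 => h (mem_singleton_iff.1 h0 ▸ hx)⟩

theorem monoCLM_toPunctured {Ω : Opens Plane} (φ : 𝓓(Ω, ℝ)) (h : (0 : Plane) ∉ tsupport φ) :
    TestFunction.monoCLM ℝ (toPunctured φ h) = φ := by
  ext x
  rw [monoCLM_test_apply (punctured_le Ω)]
  rfl

theorem zero_notMem_tsupport_of_punctured {Ω : Opens Plane} (φ : 𝓓(punctured Ω, ℝ)) :
    (0 : Plane) ∉ tsupport φ := fun h => (φ.tsupport_subset h).2 rfl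

/-! ### Norms of iterated derivatives and extension of functionals -/

section Norms

variable {V : Type*} [NormedAddCommGroup V] [NormedSpace ℝ V] {Ω : Opens V}
  {F : Type*} [NormedAddCommGroup F] [NormedSpace ℝ F]

theorem exists_bound_iteratedFDeriv {f : V → F} (hf : ContDiff ℝ ∞ f)
    (hc : HasCompactSupport f) (i : ℕ) : ∃ C, ∀ x, ‖iteratedFDeriv ℝ i f x‖ ≤ C :=
  (hf.continuous_iteratedFDeriv (by exact_mod_cast le_top)).bounded_above_of_compact_support
    (hc.iteratedFDeriv i)

/-- The `i`-th derivative of a test function as a bounded continuous function, depending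
continuously on the test function. -/
noncomputable def iteratedFDerivBCF (Ω : Opens V) (i : ℕ) :
    𝓓(Ω, F) →L[ℝ] BoundedContinuousFunction V (V [×i]→L[ℝ] F) :=
  -- Test functions carry an inductive limit topology, so continuity is checked on functions
  -- supported in a fixed compact set.
  TestFunction.limitCLM ℝ
    (fun φ => BoundedContinuousFunction.ofNormedAddCommGroup (iteratedFDeriv ℝ i φ)
      (φ.contDiff.continuous_iteratedFDeriv (by exact_mod_cast le_top))
      (exists_bound_iteratedFDeriv φ.contDiff φ.hasCompactSupport i).choose
      (exists_bound_iteratedFDeriv φ.contDiff φ.hasCompactSupport i).choose_spec)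
    (fun _ _ => ContDiffMapSupportedIn.structureMapCLM ℝ ⊤ i)
    (fun K hK f => by
      ext1 x
      rw [ContDiffMapSupportedIn.structureMapCLM_top_apply]
      rfl)

/-- The sup norm of the `i`-th derivative of a test function. -/
noncomputable def derivSeminorm (Ω : Opens V) (i : ℕ) : Seminorm ℝ 𝓓(Ω, F) :=
  (normSeminorm ℝ (BoundedContinuousFunction V (V [×i]→L[ℝ] F))).comp
    (iteratedFDerivBCF Ω i).toLinearMap

theorem derivSeminorm_le_iff {i : ℕ} {φ : 𝓓(Ω, F)} {A : ℝ} (hA : 0 ≤ A) :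
    derivSeminorm Ω i φ ≤ A ↔ ∀ x, ‖iteratedFDeriv ℝ i φ x‖ ≤ A :=
  BoundedContinuousFunction.norm_le hA

/-- The `C^m` norm of a test function. -/
noncomputable def cNorm (m : ℕ) (φ : 𝓓(Ω, F)) : ℝ :=
  ∑ i ∈ Finset.range (m + 1), derivSeminorm Ω i φ

theorem cNorm_nonneg (m : ℕ) (φ : 𝓓(Ω, F)) : 0 ≤ cNorm m φ :=
  Finset.sum_nonneg fun _ _ => apply_nonneg _ _

theorem norm_iteratedFDeriv_le_cNorm {i m : ℕ} (h : i ≤ m) (φ : 𝓓(Ω, F))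
    (x : V) : ‖iteratedFDeriv ℝ i φ x‖ ≤ cNorm m φ :=
  ((derivSeminorm_le_iff (apply_nonneg _ _)).1 le_rfl x).trans
    (Finset.single_le_sum (f := fun i => derivSeminorm Ω i φ) (fun _ _ => apply_nonneg _ _)
      (Finset.mem_range.2 (Nat.lt_succ_of_le h)))

theorem cNorm_le {m : ℕ} {φ : 𝓓(Ω, F)} {A : ℝ} (hA : 0 ≤ A)
    (h : ∀ i ≤ m, ∀ x, ‖iteratedFDeriv ℝ i φ x‖ ≤ A) : cNorm m φ ≤ (m + 1) * A := by
  calc cNorm m φ ≤ ∑ i ∈ Finset.range (m + 1), A := Finset.sum_le_sum fun i hi =>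
        (derivSeminorm_le_iff hA).2 (h i (Nat.lt_succ_iff.1 (Finset.mem_range.1 hi)))
    _ = (m + 1) * A := by simp

theorem cNorm_add_le (m : ℕ) (φ ψ : 𝓓(Ω, F)) :
    cNorm m (φ + ψ) ≤ cNorm m φ + cNorm m ψ := by
  rw [cNorm, cNorm, cNorm, ← Finset.sum_add_distrib]
  exact Finset.sum_le_sum fun i _ => map_add_le_add _ _ _

theorem cNorm_smul (m : ℕ) (c : ℝ) (φ : 𝓓(Ω, F)) : cNorm m (c • φ) = |c| * cNorm m φ := by
  rw [cNorm, cNorm, Finset.mul_sum]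
  exact Finset.sum_congr rfl fun i _ => map_smul_eq_mul _ _ _

theorem continuous_cNorm (m : ℕ) : Continuous (cNorm m : 𝓓(Ω, F) → ℝ) :=
  continuous_finsetSum _ fun i _ =>
    (continuous_norm (E := BoundedContinuousFunction V (V [×i]→L[ℝ] F))).comp
      (iteratedFDerivBCF Ω i).continuous

/-- A linear functional on test functions bounded by a `C^m` norm is a distribution. -/
noncomputable def ofBound (g : 𝓓(Ω, ℝ) →ₗ[ℝ] ℝ) (C : ℝ) (m : ℕ)
    (h : ∀ φ, |g φ| ≤ C * cNorm m φ) : 𝓓'(Ω, ℝ) :=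
  ContinuousLinearMap.toUniformConvergenceCLM _ _ _
    { g with
      cont := by
        refine continuous_of_continuousAt_zero g.toAddMonoidHom ?_
        have h0 : Tendsto (fun φ : 𝓓(Ω, ℝ) => C * cNorm m φ) (𝓝 0) (𝓝 0) := by
          have := ((continuous_cNorm m).const_mul C).tendsto (0 : 𝓓(Ω, ℝ))
          have h1 : cNorm m (0 : 𝓓(Ω, ℝ)) = 0 := by simpa using cNorm_smul m 0 (0 : 𝓓(Ω, ℝ))
          simpa [h1] using this
        have := squeeze_zero_norm (f := fun φ : 𝓓(Ω, ℝ) => g φ) (fun φ => h φ) h0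
        simpa [ContinuousAt] using this }

/-- **Hahn–Banach**: a functional on a space of test functions, bounded by a `C^m` norm, extends
to a distribution with the same bound. -/
theorem exists_extension_of_le_cNorm (f : 𝓓(Ω, ℝ) →ₗ.[ℝ] ℝ) (C : ℝ) (m : ℕ)
    (hC : 0 ≤ C) (h : ∀ φ : f.domain, |f φ| ≤ C * cNorm m (φ : 𝓓(Ω, ℝ))) :
    ∃ T : 𝓓'(Ω, ℝ), (∀ φ : f.domain, T φ = f φ) ∧ ∀ φ, |T φ| ≤ C * cNorm m φ := by
  obtain ⟨g, hg, hle⟩ := exists_extension_of_le_sublinear f (fun φ => C * cNorm m φ)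
    (fun c hc φ => by simp only [cNorm_smul, abs_of_pos hc]; ring)
    (fun φ ψ => by rw [← mul_add]; exact mul_le_mul_of_nonneg_left (cNorm_add_le m φ ψ) hC)
    (fun φ => (le_abs_self _).trans (h φ))
  -- Hahn–Banach gives only the upper bound; evaluating it at -φ gives the lower one.
  have hb : ∀ φ, |g φ| ≤ C * cNorm m φ := fun φ => by
    refine abs_le.2 ⟨?_, hle φ⟩
    have h1 := hle (-φ)
    have h2 : cNorm m (-φ) = cNorm m φ := by
      have := cNorm_smul m (-1) φ
      simpa using this
    rw [map_neg] at h1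
    simp only [h2] at h1
    linarith
  exact ⟨ofBound g C m hb, hg, hb⟩

end Norms

/-! ### Uniform boundedness on test functions supported in a compact set -/

section UniformBoundedness

variable {V : Type*} [NormedAddCommGroup V] [NormedSpace ℝ V] {Ω : Opens V}

theorem abs_le_of_cNorm_le {j : ℕ} {φ : 𝓓(Ω, ℝ)} {A : ℝ} (h : cNorm j φ ≤ A) (x : V) :
    |φ x| ≤ A := by
  have := norm_iteratedFDeriv_le_cNorm (Nat.zero_le j) φ x
  rw [norm_iteratedFDeriv_zero, Real.norm_eq_abs] at this
  exact this.trans h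

theorem summable_mul_of_cNorm_le {f : ℕ → 𝓓(Ω, ℝ)} (hf : ∀ j, cNorm j (f j) ≤ (1 / 2) ^ j)
    (c : BoundedContinuousFunction ℕ ℝ) (x : V) : Summable fun j => c j * f j x :=
  .of_norm_bounded (summable_geometric_two.mul_left ‖c‖) fun j => by
    rw [norm_mul]
    exact mul_le_mul (c.norm_coe_le_norm j) (abs_le_of_cNorm_le (hf j) x) (norm_nonneg _)
      (norm_nonneg _)

/-- The j-th term is controlled only in C^j, so the bound on k-th derivatives holds for j ≥ k;
finitely many exceptions do not affect smoothness of the sum. -/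
theorem contDiff_tsum_mul_of_cNorm_le {f : ℕ → 𝓓(Ω, ℝ)} (hf : ∀ j, cNorm j (f j) ≤ (1 / 2) ^ j)
    (c : BoundedContinuousFunction ℕ ℝ) : ContDiff ℝ ∞ fun x => ∑' j, c j * f j x := by
  refine contDiff_tsum_of_eventually (v := fun _ j => ‖c‖ * (1 / 2) ^ j)
    (fun j => contDiff_const.mul (f j).contDiff)
    (fun k _ => summable_geometric_two.mul_left ‖c‖) fun k _ => ?_
  rw [Nat.cofinite_eq_atTop]
  filter_upwards [eventually_ge_atTop k] with j hj x
  have h1 : iteratedFDeriv ℝ k (fun x => c j * f j x) x = c j • iteratedFDeriv ℝ k (f j) x := by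
    simp_rw [← smul_eq_mul]
    exact iteratedFDeriv_const_smul_apply'
      ((f j).contDiff.of_le (by exact_mod_cast le_top)).contDiffAt
  rw [h1, norm_smul]
  exact mul_le_mul (c.norm_coe_le_norm j) ((norm_iteratedFDeriv_le_cNorm hj _ x).trans (hf j))
    (norm_nonneg _) (norm_nonneg _)

theorem tsupport_tsum_mul_subset {f : ℕ → 𝓓(Ω, ℝ)} {K : Set V} (hK : IsCompact K)
    (hf : ∀ j, tsupport (f j) ⊆ K) (c : ℕ → ℝ) :
    tsupport (fun x => ∑' j, c j * f j x) ⊆ K := by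
  refine closure_minimal (fun x hx => ?_) hK.isClosed
  by_contra hxK
  refine hx ?_
  have : ∀ j, c j * f j x = 0 := fun j => by
    rw [image_eq_zero_of_notMem_tsupport fun h => hxK (hf j h), mul_zero]
  simp [this]

/-- The map from bounded sequences to test functions given by a rapidly convergent series. -/
noncomputable def seriesMap {f : ℕ → 𝓓(Ω, ℝ)} {K : Set V} (hK : IsCompact K)
    (hKΩ : K ⊆ Ω) (hf : ∀ j, cNorm j (f j) ≤ (1 / 2) ^ j) (hs : ∀ j, tsupport (f j) ⊆ K) :
    BoundedContinuousFunction ℕ ℝ →ₗ[ℝ] 𝓓(Ω, ℝ) where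
  toFun c := ⟨fun x => ∑' j, c j * f j x, contDiff_tsum_mul_of_cNorm_le hf c,
    hK.of_isClosed_subset (isClosed_tsupport _) (tsupport_tsum_mul_subset hK hs c),
    (tsupport_tsum_mul_subset hK hs c).trans hKΩ⟩
  map_add' c d := by
    ext x
    change ∑' j, (c + d) j * f j x = ∑' j, c j * f j x + ∑' j, d j * f j x
    rw [← (summable_mul_of_cNorm_le hf c x).tsum_add (summable_mul_of_cNorm_le hf d x)]
    simp [add_mul]
  map_smul' a c := by
    ext x
    change ∑' j, (a • c) j * f j x = a * ∑' j, c j * f j x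
    rw [← tsum_mul_left]
    simp [mul_assoc]

/-- A uniform boundedness principle for test functions supported in K, reduced to Banach spaces. If
it failed, there would be f_j with C^j norm at most 2^{-j} and |Λ_{n_j} f_j| > j. The map c ↦ ∑ c_j
f_j carries bounded sequences to test functions supported in K, and Banach–Steinhaus bounds the
functionals Λ_n composed with it, which the unit sequences contradict. The sup-norm estimate `hcont`
serves only to make each composite continuous. -/
theorem exists_cNorm_bound_of_pointwise_bounded {K : Set V} (hK : IsCompact K) (hKΩ : K ⊆ Ω)
    (Λ : ℕ → 𝓓(Ω, ℝ) →ₗ[ℝ] ℝ)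
    (hcont : ∀ n, ∃ C, ∀ φ : 𝓓(Ω, ℝ), tsupport φ ⊆ K → ∀ A, (∀ x, |φ x| ≤ A) → |Λ n φ| ≤ C * A)
    (hbdd : ∀ φ : 𝓓(Ω, ℝ), tsupport φ ⊆ K → ∃ C, ∀ n, |Λ n φ| ≤ C) :
    ∃ (C : ℝ) (m : ℕ), 0 ≤ C ∧ ∀ n, ∀ φ : 𝓓(Ω, ℝ), tsupport φ ⊆ K →
      |Λ n φ| ≤ C * cNorm m φ := by
  by_contra! H
  -- The factor 2^j pays for normalising the C^j norm to 2^{-j}; the factor j survives as the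
  -- unbounded value.
  choose n φ hφK hφ using fun j : ℕ => H (j * 2 ^ j) j (by positivity)
  have hpos : ∀ j, 0 < cNorm j (φ j) := fun j => by
    refine (cNorm_nonneg _ _).lt_of_ne fun h0 => ?_
    obtain ⟨C, hC⟩ := hcont (n j)
    have := hC _ (hφK j) 0 fun x => abs_le_of_cNorm_le h0.symm.le x
    have h1 := hφ j
    rw [← h0] at h1
    linarith
  set f : ℕ → 𝓓(Ω, ℝ) := fun j => (2 ^ j * cNorm j (φ j))⁻¹ • φ j with hfdef
  have hs : ∀ j, tsupport (f j) ⊆ K := fun j =>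
    (tsupport_smul_subset_right (fun _ : V => (2 ^ j * cNorm j (φ j))⁻¹) (φ j)).trans (hφK j)
  have hf : ∀ j, cNorm j (f j) ≤ (1 / 2) ^ j := fun j => by
    have := hpos j
    rw [hfdef, cNorm_smul, abs_of_pos (by positivity)]
    simp only [mul_inv, one_div, inv_pow]
    rw [mul_assoc, inv_mul_cancel₀ this.ne', mul_one]
  have hΛ : ∀ j : ℕ, (j : ℝ) < |Λ (n j) (f j)| := fun j => by
    have := hpos j
    rw [hfdef, map_smul, smul_eq_mul, abs_mul, abs_of_pos (by positivity : 0 < (2 ^ j * cNorm j (φ j))⁻¹),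
      inv_mul_eq_div, lt_div_iff₀ (by positivity)]
    linarith [hφ j]
  let S := seriesMap hK hKΩ hf hs
  have hSK : ∀ c, tsupport (S c) ⊆ K := fun c => tsupport_tsum_mul_subset hK hs c
  have hSb : ∀ c x, |S c x| ≤ ‖c‖ * 2 := fun c x => by
    have h1 : ∀ j, ‖c j * f j x‖ ≤ ‖c‖ * (1 / 2) ^ j := fun j => by
      rw [norm_mul]
      exact mul_le_mul (c.norm_coe_le_norm j) (abs_le_of_cNorm_le (hf j) x) (norm_nonneg _)
        (norm_nonneg _)
    have h2 := tsum_of_norm_bounded (summable_geometric_two.mul_left ‖c‖).hasSum h1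
    rwa [tsum_mul_left, tsum_geometric_two] at h2
  choose C hC using hcont
  let g : ℕ → BoundedContinuousFunction ℕ ℝ →L[ℝ] ℝ := fun k =>
    (Λ k ∘ₗ S).mkContinuous (C k * 2) fun c => by
      have := hC k (S c) (hSK c) _ (hSb c)
      simp only [LinearMap.comp_apply, Real.norm_eq_abs]
      linarith
  obtain ⟨B, hB⟩ := banach_steinhaus (g := g) fun c => hbdd (S c) (hSK c)
  obtain ⟨j, hj⟩ := exists_nat_ge B
  let δ : BoundedContinuousFunction ℕ ℝ :=
    BoundedContinuousFunction.ofNormedAddCommGroupDiscrete (Pi.single j 1) 1 fun i => by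
      rcases eq_or_ne i j with rfl | h
      · simp
      · simp [h]
  have hδ : ‖δ‖ ≤ 1 := BoundedContinuousFunction.norm_ofNormedAddCommGroup_le _ zero_le_one _
  have hSδ : S δ = f j := by
    ext x
    change ∑' i, δ i * f i x = f j x
    rw [tsum_eq_single j fun i hi => by simp [δ, hi]]
    simp [δ]
  have h1 : ‖g (n j) δ‖ ≤ B := ((g (n j)).le_opNorm δ).trans
    ((mul_le_of_le_one_right (norm_nonneg _) hδ).trans (hB _))
  have h2 : g (n j) δ = Λ (n j) (f j) := by
    rw [← hSδ]; rfl
  rw [h2, Real.norm_eq_abs] at h1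
  linarith [hΛ j]

end UniformBoundedness

/-! ### Functions vanishing to high order at the origin -/

section Vanishing

variable {V : Type*} [NormedAddCommGroup V] [NormedSpace ℝ V]

/-- Descending induction from order m: the mean value inequality on the ball of radius ‖x‖ gains one
factor ‖x‖ for each order lost. -/
theorem norm_iteratedFDeriv_le_of_vanishing {φ : V → ℝ} (hφ : ContDiff ℝ ∞ φ) {m : ℕ} {A : ℝ}
    (h0 : ∀ j < m, iteratedFDeriv ℝ j φ 0 = 0) (hA : ∀ x, ‖iteratedFDeriv ℝ m φ x‖ ≤ A)
    {d i : ℕ} (hd : i + d = m) (x : V) : ‖iteratedFDeriv ℝ i φ x‖ ≤ ‖x‖ ^ d * A := by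
  have hA0 : 0 ≤ A := (norm_nonneg _).trans (hA 0)
  induction d generalizing i x with
  | zero =>
    obtain rfl : i = m := by simpa using hd
    simpa using hA x
  | succ d ih =>
    have hdiff : Differentiable ℝ (iteratedFDeriv ℝ i φ) :=
      hφ.differentiable_iteratedFDeriv (by exact_mod_cast ENat.natCast_lt_top i)
    have h1 := (convex_closedBall (0 : V) ‖x‖).norm_image_sub_le_of_norm_fderiv_le
      (f := iteratedFDeriv ℝ i φ) (𝕜 := ℝ) (C := ‖x‖ ^ d * A) (fun y _ => hdiff y)
      (fun y hy => by
        rw [norm_fderiv_iteratedFDeriv]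
        refine (ih (i := i + 1) (by omega) y).trans ?_
        gcongr
        simpa using hy)
      (mem_closedBall_self (norm_nonneg x)) (y := x) (by simp)
    rw [h0 i (by omega), sub_zero, sub_zero] at h1
    calc _ ≤ _ := h1
      _ = _ := by ring

/-- On the unit ball the j-th derivative of φ(s·) is s^j times a derivative of φ at a point of norm
at most s, which is at most s^{m-j} A by vanishing at 0. All orders thus gain the same s^m, and the
Leibniz rule puts η back in. -/
theorem exists_bound_iteratedFDeriv_mul_comp_smul {η : V → ℝ} (hη : ContDiff ℝ ∞ η)
    (hc : HasCompactSupport η) (hs : tsupport η ⊆ closedBall 0 1) {M m : ℕ} (hM : M ≤ m) :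
    ∃ C, 0 ≤ C ∧ ∀ φ : V → ℝ, ContDiff ℝ ∞ φ → (∀ j < m, iteratedFDeriv ℝ j φ 0 = 0) →
      ∀ A, (∀ x, ‖iteratedFDeriv ℝ m φ x‖ ≤ A) → ∀ s : ℝ, 0 < s → s ≤ 1 → ∀ i ≤ M, ∀ x,
        ‖iteratedFDeriv ℝ i (fun y => η y * φ (s • y)) x‖ ≤ C * s ^ m * A := by
  choose B hB using exists_bound_iteratedFDeriv hη hc
  have hB0 : ∀ i, 0 ≤ B i := fun i => (norm_nonneg _).trans (hB i 0)
  set B' := ∑ i ∈ Finset.range (M + 1), B i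
  have hB0' : 0 ≤ B' := Finset.sum_nonneg fun i _ => hB0 i
  have hBB : ∀ i ≤ M, B i ≤ B' := fun i hi =>
    Finset.single_le_sum (f := B) (fun i _ => hB0 i) (Finset.mem_range.2 (Nat.lt_succ_of_le hi))
  refine ⟨2 ^ M * B', by positivity, fun φ hφ h0 A hA s hs0 hs1 i hi x => ?_⟩
  have hA0 : 0 ≤ A := (norm_nonneg _).trans (hA 0)
  by_cases hx : x ∈ closedBall (0 : V) 1
  · have hx1 : ‖x‖ ≤ 1 := by simpa using hx
    have hφs : ContDiff ℝ ∞ fun y : V => φ (s • y) := hφ.comp (contDiff_const_smul s)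
    have hterm : ∀ j ≤ m, ‖iteratedFDeriv ℝ j (fun y => φ (s • y)) x‖ ≤ s ^ m * A := fun j hj => by
      rw [iteratedFDeriv_comp_const_smul s (hφ.of_le (by exact_mod_cast le_top)), norm_smul,
        norm_pow, Real.norm_of_nonneg hs0.le]
      have h1 := norm_iteratedFDeriv_le_of_vanishing hφ h0 hA (Nat.add_sub_cancel' hj) (s • x)
      rw [norm_smul, Real.norm_of_nonneg hs0.le] at h1
      have h2 : (s * ‖x‖) ^ (m - j) ≤ s ^ (m - j) :=
        pow_le_pow_left₀ (by positivity) (mul_le_of_le_one_right hs0.le hx1) _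
      calc s ^ j * ‖iteratedFDeriv ℝ j φ (s • x)‖ ≤ s ^ j * (s ^ (m - j) * A) := by
            refine mul_le_mul_of_nonneg_left (h1.trans ?_) (by positivity)
            exact mul_le_mul_of_nonneg_right h2 hA0
        _ = s ^ m * A := by rw [← mul_assoc, ← pow_add, Nat.add_sub_cancel' hj]
    refine (norm_iteratedFDeriv_mul_le hη hφs x (n := i) (by exact_mod_cast le_top)).trans ?_
    calc _ ≤ ∑ j ∈ Finset.range (i + 1), (i.choose j : ℝ) * (B' * (s ^ m * A)) := by
          refine Finset.sum_le_sum fun j hj => ?_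
          rw [mul_assoc]
          have hj' : j ≤ i := Nat.lt_succ_iff.1 (Finset.mem_range.1 hj)
          refine mul_le_mul_of_nonneg_left ?_ (by positivity)
          exact mul_le_mul ((hB j x).trans (hBB j (by omega))) (hterm _ (by omega))
            (norm_nonneg _) hB0'
      _ = 2 ^ i * (B' * (s ^ m * A)) := by
          rw [← Finset.sum_mul]
          congr 1
          exact_mod_cast Nat.sum_range_choose i
      _ ≤ 2 ^ M * (B' * (s ^ m * A)) := by
          gcongr
          norm_num
      _ = 2 ^ M * B' * s ^ m * A := by ring
  · have : iteratedFDeriv ℝ i (fun y => η y * φ (s • y)) x = 0 := by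
      refine image_eq_zero_of_notMem_tsupport fun h => hx (hs ?_)
      exact tsupport_mul_subset_left (tsupport_iteratedFDeriv_subset i h)
    rw [this, norm_zero]
    positivity

end Vanishing

/-! ### Extension of functions of finite scaling degree -/

theorem cNorm_congr {U Ω : Opens Plane} {φ : 𝓓(U, ℝ)} {ψ : 𝓓(Ω, ℝ)} (h : (φ : Plane → ℝ) = ψ)
    (m : ℕ) : cNorm m φ = cNorm m ψ := by
  refine Finset.sum_congr rfl fun i _ => le_antisymm ?_ ?_
  · rw [derivSeminorm_le_iff (apply_nonneg _ _), h]
    exact (derivSeminorm_le_iff (apply_nonneg _ _)).1 le_rfl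
  · rw [derivSeminorm_le_iff (apply_nonneg _ _), ← h]
    exact (derivSeminorm_le_iff (apply_nonneg _ _)).1 le_rfl

/-- Multiplication of test functions by a smooth function. -/
noncomputable def mulTest {Ω : Opens Plane} (h : Plane → ℝ) (hh : ContDiff ℝ ∞ h) :
    𝓓(Ω, ℝ) →ₗ[ℝ] 𝓓(Ω, ℝ) where
  toFun φ := mkTest (fun x => h x * φ x) (hh.mul (smooth φ)) φ.hasCompactSupport.mul_left
    ((tsupport_mul_subset_right (f := h) (g := φ)).trans φ.tsupport_subset)
  map_add' φ ψ := by
    ext x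
    exact mul_add _ _ _
  map_smul' c φ := by
    ext x
    exact mul_left_comm _ _ _

theorem mulTest_apply {Ω : Opens Plane} {h : Plane → ℝ} (hh : ContDiff ℝ ∞ h) (φ : 𝓓(Ω, ℝ))
    (x : Plane) : mulTest h hh φ x = h x * φ x := rfl

theorem regular_comp_smul {U W : Opens Plane} {g : Plane → ℝ} {s : ℝ} (hs : 0 < s)
    (hg : ContDiffOn ℝ ∞ g U) (hgs : ContDiffOn ℝ ∞ (fun y => g (s • y)) W)
    (φ : 𝓓(W, ℝ)) (ψ : 𝓓(U, ℝ)) (h : ∀ y, ψ (s • y) = φ y) :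
    regular W (fun y => g (s • y)) φ = (s ^ 2)⁻¹ * regular U g ψ := by
  rw [regular_apply_of_contDiffOn hg, regular_apply_of_contDiffOn hgs]
  have := Measure.integral_comp_smul (volume : Measure Plane) (fun x => ψ x * g x) s
  simp only [h, finrank_euclideanSpace, Fintype.card_fin, smul_eq_mul] at this
  rw [this, abs_of_pos (by positivity)]

theorem contDiffOn_comp_smul_punctured {Ω : Opens Plane} {g : Plane → ℝ}
    (hg : ContDiffOn ℝ ∞ g (punctured Ω)) {r : ℝ} (hr : openBall r ≤ Ω) {s : ℝ} (hs : 0 < s)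
    (hs1 : s ≤ 1) : ContDiffOn ℝ ∞ (fun y => g (s • y)) (punctured (openBall r)) := by
  refine hg.comp (contDiff_const_smul s).contDiffOn fun y hy => ⟨hr ?_, fun h0 => hy.2 ?_⟩
  · have : ‖y‖ < r := mem_ball_zero_iff.1 hy.1
    refine mem_ball_zero_iff.2 ?_
    rw [norm_smul, Real.norm_of_nonneg hs.le]
    exact (mul_le_of_le_one_left (norm_nonneg y) hs1).trans_lt this
  · simpa [hs.ne'] using h0

theorem rescale_apply {r s : ℝ} (h0 : 0 < s) (h1 : s < 1) (φ : 𝓓(punctured (openBall r), ℝ))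
    (x : Plane) : rescale s φ x = (s ^ 2)⁻¹ * φ (s⁻¹ • x) := by
  rw [rescale, dif_pos ⟨h0, h1⟩]
  rfl

/-- The factor s⁻² in `rescale` is the Jacobian in dimension two, so scaling a function as a
distribution is just replacing it by g(s·). -/
theorem restrictTo_regular_rescale {Ω : Opens Plane} {g : Plane → ℝ}
    (hg : ContDiffOn ℝ ∞ g (punctured Ω)) {r : ℝ} (hr : openBall r ≤ Ω) {s : ℝ} (hs : 0 < s)
    (hs1 : s < 1) (φ : 𝓓(punctured (openBall r), ℝ)) :
    restrictTo (regular (punctured Ω) g) (punctured (openBall r)) (rescale s φ) =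
      regular (punctured (openBall r)) (fun y => g (s • y)) φ := by
  have hle : punctured (openBall r) ≤ punctured Ω := fun x hx => ⟨hr hx.1, hx.2⟩
  have hgs := contDiffOn_comp_smul_punctured hg hr hs hs1.le
  have := regular_comp_smul hs hg hgs φ
    (s ^ 2 • TestFunction.monoCLM ℝ (rescale s φ) : 𝓓(punctured Ω, ℝ)) fun y => by
      change s ^ 2 * _ = _
      rw [monoCLM_test_apply hle, rescale_apply hs hs1, inv_smul_smul₀ hs.ne',
        mul_inv_cancel_left₀ (by positivity)]
  rw [this, map_smul, smul_eq_mul, inv_mul_cancel_left₀ (by positivity)]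
  rfl

theorem abs_regular_le {U : Opens Plane} {g : Plane → ℝ} (hg : ContDiffOn ℝ ∞ g U)
    {K : Set Plane} (hK : IsCompact K) (hKU : K ⊆ U) :
    ∃ C, ∀ φ : 𝓓(U, ℝ), tsupport φ ⊆ K → ∀ A, (∀ x, |φ x| ≤ A) → |regular U g φ| ≤ C * A := by
  obtain ⟨G, hG⟩ := hK.exists_bound_of_continuousOn (hg.continuousOn.mono hKU)
  refine ⟨volume.real K * G, fun φ hφ A hA => ?_⟩
  have hzero : ∀ x ∉ K, φ x * g x = 0 := fun x hx => by
    rw [image_eq_zero_of_notMem_tsupport fun h => hx (hφ h), zero_mul]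
  rw [regular_apply_of_contDiffOn hg, ← setIntegral_eq_integral_of_forall_compl_eq_zero hzero,
    ← Real.norm_eq_abs]
  refine (norm_setIntegral_le_of_norm_le_const (C := A * G) hK.measure_lt_top fun x hx => ?_).trans
    (by linarith)
  rw [norm_mul]
  exact mul_le_mul (hA x) (hG x hx) (norm_nonneg _) ((abs_nonneg _).trans (hA x))

/-- The scaling hypothesis is a statement for each test function separately; along the sequence s =
2^{-n} the uniform boundedness principle turns it into one estimate in a C^m norm. -/
theorem exists_cNorm_bound_dyadic {Ω : Opens Plane} {g : Plane → ℝ}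
    (hg : ContDiffOn ℝ ∞ g (punctured Ω)) {r k : ℝ} (hr : openBall r ≤ Ω)
    (hs : ScalesToZero (regular (punctured Ω) g) r k) {K : Set Plane} (hK : IsCompact K)
    (hKr : K ⊆ punctured (openBall r)) :
    ∃ (C : ℝ) (m l : ℕ), 0 ≤ C ∧ ∀ n : ℕ, ∀ φ : 𝓓(punctured (openBall r), ℝ), tsupport φ ⊆ K →
      ((1 / 2 : ℝ) ^ n) ^ l *
        |regular (punctured (openBall r)) (fun y => g ((1 / 2 : ℝ) ^ n • y)) φ| ≤
          C * cNorm m φ := by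
  -- Raising k to a natural exponent only weakens the estimate, because s ≤ 1.
  obtain ⟨l, hl⟩ := exists_nat_ge k
  have hs0 : ∀ n : ℕ, (0 : ℝ) < (1 / 2) ^ n := fun n => by positivity
  have hs1 : ∀ n : ℕ, (1 / 2 : ℝ) ^ n ≤ 1 := fun n => pow_le_one₀ (by norm_num) (by norm_num)
  have hgn := fun n : ℕ => contDiffOn_comp_smul_punctured hg hr (hs0 n) (hs1 n)
  set Λ : ℕ → 𝓓(punctured (openBall r), ℝ) →ₗ[ℝ] ℝ := fun n =>
    (((1 / 2 : ℝ) ^ n) ^ l •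
      regular (punctured (openBall r)) (fun y => g ((1 / 2 : ℝ) ^ n • y))).toLinearMap with hΛ
  have hΛa : ∀ n φ, |Λ n φ| = ((1 / 2 : ℝ) ^ n) ^ l *
      |regular (punctured (openBall r)) (fun y => g ((1 / 2 : ℝ) ^ n • y)) φ| := fun n φ => by
    have : Λ n φ = ((1 / 2 : ℝ) ^ n) ^ l *
      regular (punctured (openBall r)) (fun y => g ((1 / 2 : ℝ) ^ n • y)) φ := rfl
    rw [this, abs_mul, abs_of_pos (by positivity)]
  obtain ⟨C, m, hC, h⟩ := exists_cNorm_bound_of_pointwise_bounded hK hKr Λ (fun n => by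
    obtain ⟨C, hC⟩ := abs_regular_le (hgn n) hK hKr
    refine ⟨((1 / 2 : ℝ) ^ n) ^ l * C, fun φ hφ A hA => ?_⟩
    rw [hΛa, mul_assoc]
    exact mul_le_mul_of_nonneg_left (hC φ hφ A hA) (by positivity)) (fun φ _ => by
    have hlim : Tendsto (fun n : ℕ => (1 / 2 : ℝ) ^ n) atTop (𝓝[>] 0) :=
      tendsto_nhdsWithin_iff.2 ⟨tendsto_pow_atTop_nhds_zero_of_lt_one (by norm_num) (by norm_num),
        Eventually.of_forall hs0⟩
    have h1 := (hs φ).comp hlim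
    have h2 : Tendsto (fun n => Λ n φ) atTop (𝓝 0) := by
      have h0 := h1.abs
      rw [abs_zero] at h0
      refine squeeze_zero_norm' ?_ h0
      -- At n = 0 the scale is 1, where `rescale` takes its default value 0.
      filter_upwards [eventually_ge_atTop 1] with n hn
      have hlt : (1 / 2 : ℝ) ^ n < 1 := pow_lt_one₀ (by norm_num) (by norm_num) (by omega)
      rw [Real.norm_eq_abs, hΛa]
      simp only [Function.comp_apply]
      rw [restrictTo_regular_rescale hg hr (hs0 n) hlt, abs_mul,
        abs_of_pos (Real.rpow_pos_of_pos (hs0 n) k)]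
      refine mul_le_mul_of_nonneg_right ?_ (abs_nonneg _)
      rw [← Real.rpow_natCast _ l]
      exact Real.rpow_le_rpow_of_exponent_ge (hs0 n) hlt.le hl
    obtain ⟨C, hC⟩ := (isBounded_range_of_tendsto _ h2).exists_norm_le
    exact ⟨C, fun n => hC _ (mem_range_self n)⟩)
  exact ⟨C, m, l, hC, fun n φ hφ => by rw [← hΛa]; exact h n φ hφ⟩

theorem iteratedFDeriv_eq_zero_of_notMem_tsupport {φ : Plane → ℝ} {x : Plane} (h : x ∉ tsupport φ)
    (j : ℕ) : iteratedFDeriv ℝ j φ x = 0 :=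
  image_eq_zero_of_notMem_tsupport fun h' => h (tsupport_iteratedFDeriv_subset j h')

/-- Near O, χ is the sum of the dyadic pieces ψ(2^n ·) with ψ = χ - χ(2·) supported in a fixed
annulus. Rescaling a piece to that annulus costs s^{-l}, but φ vanishes near O and hence to every
order at O, which gains s^{M+l}. The pieces are therefore summable, with a bound independent of how
close to O the support of φ comes. -/
theorem exists_cNorm_bound_of_scalesToZero {Ω : Opens Plane} {g : Plane → ℝ}
    (hg : ContDiffOn ℝ ∞ g (punctured Ω)) {r k : ℝ} (hr : openBall r ≤ Ω)
    (hs : ScalesToZero (regular (punctured Ω) g) r k) {ρ : ℝ} (hρ : 0 < ρ) (hρ1 : ρ ≤ 1)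
    (hρr : ρ ≤ r) {χ : Plane → ℝ} (hχ : ContDiff ℝ ∞ χ) (hχ1 : ∀ x, ‖x‖ ≤ ρ / 4 → χ x = 1)
    (hχ0 : ∀ x, ρ / 2 ≤ ‖x‖ → χ x = 0) :
    ∃ (C : ℝ) (m : ℕ), 0 ≤ C ∧ ∀ φ : 𝓓(punctured Ω, ℝ),
      |regular (punctured Ω) g (mulTest χ hχ φ)| ≤ C * cNorm m φ := by
  set K : Set Plane := closedBall 0 (ρ / 2) \ ball 0 (ρ / 8) with hKdef
  have hK : IsCompact K := (isCompact_closedBall _ _).diff isOpen_ball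
  have hKr : K ⊆ punctured (openBall r) := fun x hx => by
    have h1 : ‖x‖ ≤ ρ / 2 := by simpa using hx.1
    have h2 : ρ / 8 ≤ ‖x‖ := by simpa using hx.2
    refine ⟨mem_ball_zero_iff.2 (by linarith), fun h0 => ?_⟩
    rw [mem_singleton_iff.1 h0, norm_zero] at h2
    linarith
  obtain ⟨C₁, M, l, hC₁, hdy⟩ := exists_cNorm_bound_dyadic hg hr hs hK hKr
  set ψ : Plane → ℝ := fun x => χ x - χ ((2 : ℝ) • x) with hψdef
  have hψ : ContDiff ℝ ∞ ψ := hχ.sub (hχ.comp (contDiff_const_smul (2 : ℝ)))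
  have hn2 : ∀ x : Plane, ‖(2 : ℝ) • x‖ = 2 * ‖x‖ := fun x => by simp [norm_smul]
  have hψK : tsupport ψ ⊆ K := by
    refine closure_minimal (fun x hx => ?_) hK.isClosed
    by_contra hxK
    refine hx ?_
    by_cases h1 : ‖x‖ ≤ ρ / 2
    · have h2 : ‖x‖ < ρ / 8 := by
        by_contra h2
        exact hxK ⟨by simpa using h1, by simpa using h2⟩
      simp only [hψdef]
      rw [hχ1 x (by linarith), hχ1 _ (by rw [hn2]; linarith), sub_self]
    · simp only [hψdef]
      rw [hχ0 x (by linarith), hχ0 _ (by rw [hn2]; linarith), sub_self]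
  have hψc : HasCompactSupport ψ := hK.of_isClosed_subset (isClosed_tsupport _) hψK
  obtain ⟨C₂, hC₂, hsc⟩ := exists_bound_iteratedFDeriv_mul_comp_smul hψ hψc
    (hψK.trans (sdiff_subset.trans (closedBall_subset_closedBall (by linarith))))
    (Nat.le_add_right M l)
  have hbound : ∀ (φ : 𝓓(punctured Ω, ℝ)) (n : ℕ),
      |regular (punctured Ω) g (mulTest (fun x => ψ ((2 : ℝ) ^ n • x))
        (hψ.comp (contDiff_const_smul _)) φ)| ≤
        C₁ * ((M + 1) * C₂) * cNorm (M + l) φ * (1 / 2) ^ n := by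
    intro φ n
    set s : ℝ := (1 / 2) ^ n with hsdef
    have hs0 : 0 < s := by positivity
    have hs1 : s ≤ 1 := pow_le_one₀ (by norm_num) (by norm_num)
    have h2s : (2 : ℝ) ^ n * s = 1 := by rw [hsdef, ← mul_pow]; norm_num
    let F : 𝓓(punctured (openBall r), ℝ) := mkTest (fun y => ψ y * φ (s • y))
      (hψ.mul ((smooth φ).comp (contDiff_const_smul s))) hψc.mul_right
      ((tsupport_mul_subset_left (f := ψ)).trans (hψK.trans hKr))
    have h1 := hdy n F ((tsupport_mul_subset_left (f := ψ)).trans hψK)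
    have h2 : cNorm M F ≤ (M + 1) * (C₂ * s ^ (M + l) * cNorm (M + l) φ) :=
      cNorm_le (by have := cNorm_nonneg (M + l) φ; positivity)
        (hsc φ (smooth φ) (fun j _ => iteratedFDeriv_eq_zero_of_notMem_tsupport
          (zero_notMem_tsupport_of_punctured φ) j) _
          (norm_iteratedFDeriv_le_cNorm le_rfl φ) s hs0 hs1)
    rw [← hsdef, regular_comp_smul hs0 hg (contDiffOn_comp_smul_punctured hg hr hs0 hs1) F
      (mulTest (fun x => ψ ((2 : ℝ) ^ n • x)) (hψ.comp (contDiff_const_smul _)) φ) (fun y => by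
        rw [mulTest_apply, smul_smul, h2s, one_smul]; rfl), abs_mul,
      abs_of_pos (by positivity : 0 < (s ^ 2)⁻¹)] at h1
    set R := |regular (punctured Ω) g (mulTest (fun x => ψ ((2 : ℝ) ^ n • x))
        (hψ.comp (contDiff_const_smul _)) φ)|
    set N := cNorm (M + l) φ
    have hN : 0 ≤ N := cNorm_nonneg _ _
    have h3 : s ^ l * ((s ^ 2)⁻¹ * R) ≤ C₁ * ((M + 1) * (C₂ * s ^ (M + l) * N)) :=
      h1.trans (mul_le_mul_of_nonneg_left h2 hC₁)
    -- The Jacobian contributes s², and the loss s^{-l} cancels against s^{M+l}, leaving s^{M+2} ≤ s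
    -- = 2^{-n}.
    have h4 : s ^ l * R ≤ s ^ l * (C₁ * ((M + 1) * C₂) * N * s ^ (M + 2)) := by
      calc s ^ l * R = s ^ 2 * (s ^ l * ((s ^ 2)⁻¹ * R)) := by field_simp
        _ ≤ s ^ 2 * (C₁ * ((M + 1) * (C₂ * s ^ (M + l) * N))) :=
          mul_le_mul_of_nonneg_left h3 (by positivity)
        _ = _ := by ring
    refine (le_of_mul_le_mul_left h4 (by positivity)).trans ?_
    refine mul_le_mul_of_nonneg_left ?_ (by positivity)
    calc s ^ (M + 2) = s ^ (M + 1) * s := by ring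
      _ ≤ s := mul_le_of_le_one_left hs0.le (pow_le_one₀ hs0.le hs1)
  refine ⟨C₁ * ((M + 1) * C₂) * 2, M + l, by positivity, fun φ => ?_⟩
  -- For a given φ, finitely many pieces suffice: the telescoping remainder χ(2^N ·) is supported
  -- where φ vanishes.
  obtain ⟨δ, hδ, hball⟩ := Metric.isOpen_iff.1 (isClosed_tsupport φ).isOpen_compl 0
    (zero_notMem_tsupport_of_punctured φ)
  obtain ⟨N, hN⟩ := pow_unbounded_of_one_lt (ρ / 2 / δ) (one_lt_two : (1 : ℝ) < 2)
  have hsum : mulTest χ hχ φ = ∑ n ∈ Finset.range N, mulTest (fun x => ψ ((2 : ℝ) ^ n • x))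
      (hψ.comp (contDiff_const_smul _)) φ := by
    ext x
    have hx : (∑ n ∈ Finset.range N, mulTest (fun x => ψ ((2 : ℝ) ^ n • x))
        (hψ.comp (contDiff_const_smul _)) φ : 𝓓(punctured Ω, ℝ)) x =
        ∑ n ∈ Finset.range N, ψ ((2 : ℝ) ^ n • x) * φ x := by
      simp [mulTest_apply]
    rw [hx, mulTest_apply, ← Finset.sum_mul]
    have htel : ∑ n ∈ Finset.range N, ψ ((2 : ℝ) ^ n • x) = χ x - χ ((2 : ℝ) ^ N • x) := by
      simp only [hψdef, smul_smul, ← pow_succ']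
      rw [Finset.sum_range_sub' (fun n => χ ((2 : ℝ) ^ n • x))]
      simp
    rw [htel]
    by_cases hxδ : ‖x‖ < δ
    · have : φ x = 0 := image_eq_zero_of_notMem_tsupport (hball (mem_ball_zero_iff.2 hxδ))
      rw [this, mul_zero, mul_zero]
    · rw [hχ0 ((2 : ℝ) ^ N • x), sub_zero]
      rw [norm_smul, norm_pow, Real.norm_two]
      rw [div_lt_iff₀ hδ] at hN
      exact hN.le.trans (mul_le_mul_of_nonneg_left (not_lt.1 hxδ) (by positivity))
  rw [hsum, map_sum]
  refine (Finset.abs_sum_le_sum_abs _ _).trans ((Finset.sum_le_sum fun n _ => hbound φ n).trans ?_)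
  rw [← Finset.mul_sum]
  have hgeo : ∑ n ∈ Finset.range N, (1 / 2 : ℝ) ^ n ≤ 2 := sum_geometric_two_le N
  have hnn : 0 ≤ C₁ * ((M + 1) * C₂) * cNorm (M + l) φ := by
    have := cNorm_nonneg (M + l) φ
    positivity
  calc _ ≤ C₁ * ((M + 1) * C₂) * cNorm (M + l) φ * 2 := mul_le_mul_of_nonneg_left hgeo hnn
    _ = _ := by ring

theorem injective_monoCLM {U Ω : Opens Plane} (h : U ≤ Ω) :
    Function.Injective (TestFunction.monoCLM ℝ : 𝓓(U, ℝ) →L[ℝ] 𝓓(Ω, ℝ)) := fun φ ψ hφψ => by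
  ext x
  rw [← monoCLM_test_apply h, hφψ, monoCLM_test_apply h]

/-- A smooth function on `Ω - O` whose scaling degree is less than `∞` extends to a distribution
on `Ω` of finite order near the origin. -/
theorem exists_extension_of_scalesToZero {Ω : Opens Plane} {g : Plane → ℝ}
    (hg : ContDiffOn ℝ ∞ g (punctured Ω)) {r k : ℝ} (hr0 : 0 < r) (hr : openBall r ≤ Ω)
    (hs : ScalesToZero (regular (punctured Ω) g) r k) :
    ∃ (T : 𝓓'(Ω, ℝ)) (δ C : ℝ) (m : ℕ), 0 < δ ∧ 0 ≤ C ∧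
      restrictTo T (punctured Ω) = regular (punctured Ω) g ∧
      ∀ φ : 𝓓(Ω, ℝ), tsupport φ ⊆ closedBall 0 δ → |T φ| ≤ C * cNorm m φ := by
  set ρ := min r 1
  have hρ : 0 < ρ := lt_min hr0 one_pos
  let b : ContDiffBump (0 : Plane) := ⟨ρ / 4, ρ / 2, by positivity, by linarith⟩
  have hb : ContDiff ℝ ∞ b := b.contDiff
  have hb1 : ∀ x, ‖x‖ ≤ ρ / 4 → b x = 1 := fun x hx =>
    b.one_of_mem_closedBall (by simpa using hx)
  have hb0 : ∀ x, ρ / 2 ≤ ‖x‖ → b x = 0 := fun x hx =>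
    b.zero_of_le_dist (by simpa using hx)
  obtain ⟨C, m, hC, hbound⟩ := exists_cNorm_bound_of_scalesToZero hg hr hs hρ (min_le_right _ _)
    (min_le_left _ _) hb hb1 hb0
  have hle := punctured_le Ω
  let ι : 𝓓(punctured Ω, ℝ) →ₗ[ℝ] 𝓓(Ω, ℝ) := (TestFunction.monoCLM ℝ).toLinearMap
  let eqv := LinearEquiv.ofInjective ι (injective_monoCLM hle)
  have heqv : ∀ φ, (eqv φ : 𝓓(Ω, ℝ)) = TestFunction.monoCLM ℝ φ := fun φ => rfl
  -- Only the part b·g near O needs Hahn–Banach, applied on the test functions extended by zero from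
  -- Ω - O. The rest, (1 - b)·g, is smooth on all of Ω, vanishes near O, and is added back
  -- afterwards.
  let L : 𝓓(punctured Ω, ℝ) →ₗ[ℝ] ℝ :=
    (regular (punctured Ω) g).toLinearMap ∘ₗ mulTest b hb
  have hL : ∀ φ, L φ = regular (punctured Ω) g (mulTest b hb φ) := fun φ => rfl
  obtain ⟨T, hT, hTb⟩ := exists_extension_of_le_cNorm
    ⟨LinearMap.range ι, L ∘ₗ eqv.symm.toLinearMap⟩ C m hC fun φ => by
      obtain ⟨φ, rfl⟩ := eqv.surjective φ
      have h1 : cNorm m (eqv φ : 𝓓(Ω, ℝ)) = cNorm m φ :=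
        cNorm_congr (by rw [heqv, coe_monoCLM_test hle]) m
      change |L (eqv.symm (eqv φ))| ≤ _
      rw [LinearEquiv.symm_apply_apply, h1, hL]
      exact hbound φ
  have hT' : ∀ φ, T (TestFunction.monoCLM ℝ φ) = L φ := fun φ => by
    rw [← heqv, hT (eqv φ)]
    change L (eqv.symm (eqv φ)) = _
    rw [LinearEquiv.symm_apply_apply]
  have hg' : ContDiffOn ℝ ∞ (fun x => (1 - b x) * g x) Ω := by
    intro x hx
    by_cases h0 : x = 0
    · have : (fun x => (1 - b x) * g x) =ᶠ[𝓝 x] fun _ => 0 := by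
        filter_upwards [(isOpen_ball (x := (0 : Plane)) (ε := ρ / 4)).mem_nhds
          (by rw [h0]; exact mem_ball_self (by positivity))] with y hy
        rw [hb1 y (mem_ball_zero_iff.1 hy).le, sub_self, zero_mul]
      exact (contDiffAt_const.congr_of_eventuallyEq this).contDiffWithinAt
    · exact ((contDiff_const.sub hb).contDiffAt.mul
        (hg.contDiffAt ((punctured Ω).isOpen.mem_nhds ⟨hx, h0⟩))).contDiffWithinAt
  refine ⟨T + regular Ω fun x => (1 - b x) * g x, ρ / 4, C, m, by positivity, hC, ?_, ?_⟩
  · ext φ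
    have h1 : restrictTo (T + regular Ω fun x => (1 - b x) * g x) (punctured Ω) φ =
      T (TestFunction.monoCLM ℝ φ) +
        regular Ω (fun x => (1 - b x) * g x) (TestFunction.monoCLM ℝ φ) := rfl
    have h2 : regular Ω (fun x => (1 - b x) * g x) (TestFunction.monoCLM ℝ φ) =
        regular (punctured Ω) g (φ - mulTest b hb φ) := by
      rw [regular_apply_of_contDiffOn hg', regular_apply_of_contDiffOn hg, coe_monoCLM_test hle]
      refine integral_congr_ae (Eventually.of_forall fun x => ?_)
      change φ x * ((1 - b x) * g x) = (φ x - b x * φ x) * g x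
      ring
    rw [h1, h2, hT', hL, map_sub]
    ring
  · intro φ hφ
    have h1 : (T + regular Ω fun x => (1 - b x) * g x) φ =
      T φ + regular Ω (fun x => (1 - b x) * g x) φ := rfl
    have h2 : regular Ω (fun x => (1 - b x) * g x) φ = 0 := by
      rw [regular_apply_of_contDiffOn hg']
      refine integral_eq_zero_of_ae (Eventually.of_forall fun x => ?_)
      by_cases hx : x ∈ tsupport φ
      · simp [hb1 x (by simpa using hφ hx)]
      · simp [image_eq_zero_of_notMem_tsupport hx]
    rw [h1, h2, add_zero]
    exact hTb φ

/-! ### Derivatives of regular distributions -/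

theorem contDiffOn_fderiv_apply {U : Opens Plane} {f : Plane → ℝ} (hf : ContDiffOn ℝ ∞ f U)
    (v : Plane) : ContDiffOn ℝ ∞ (fun x => fderiv ℝ f x v) U :=
  (hf.fderiv_of_isOpen U.isOpen (by simp)).clm_apply contDiffOn_const

theorem differentiableAt_of_contDiffOn {U : Opens Plane} {f : Plane → ℝ}
    (hf : ContDiffOn ℝ ∞ f U) {x : Plane} (hx : x ∈ U) : DifferentiableAt ℝ f x :=
  (hf.contDiffAt (U.isOpen.mem_nhds hx)).differentiableAt (by simp)

theorem integrable_mul_of_contDiffOn {U : Opens Plane} {f : Plane → ℝ} (hf : ContDiffOn ℝ ∞ f U)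
    (φ : 𝓓(U, ℝ)) : Integrable fun x => φ x * f x :=
  TestFunction.integrable_bilin (ContinuousLinearMap.mul ℝ ℝ)
    (locallyIntegrableOn_of_contDiffOn hf) φ

theorem lineDerivOp_regular {U : Opens Plane} {f : Plane → ℝ} (hf : ContDiffOn ℝ ∞ f U)
    (v : Plane) : ∂_{v} (regular U f) = regular U fun x => fderiv ℝ f x v := by
  ext φ
  have hf' := contDiffOn_fderiv_apply hf v
  rw [Distribution.lineDerivOp_apply_apply, map_neg, regular_apply_of_contDiffOn hf,
    regular_apply_of_contDiffOn hf', neg_eq_iff_eq_neg]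
  have h1 := integrable_mul_of_contDiffOn hf (∂_{v} φ)
  have h2 := integrable_mul_of_contDiffOn hf' φ
  have h3 := integrable_mul_of_contDiffOn hf φ
  rw [coe_lineDerivOp_test] at h1 ⊢
  simp only [mul_comm (fderiv ℝ φ _ v), mul_comm (φ _)] at h1 h2 h3 ⊢
  exact integral_mul_fderiv_eq_neg_fderiv_mul_of_integrable h2 h1 h3
    (fun x hx => differentiableAt_of_contDiffOn hf (φ.tsupport_subset hx))
    (fun x _ => (smooth φ).differentiable (by simp) x)

theorem regular_sub {U : Opens Plane} {f g : Plane → ℝ} (hf : ContDiffOn ℝ ∞ f U)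
    (hg : ContDiffOn ℝ ∞ g U) :
    regular U f - regular U g = regular U fun x => f x - g x := by
  ext φ
  have h : (regular U f - regular U g) φ = regular U f φ - regular U g φ := rfl
  rw [h, regular_apply_of_contDiffOn hf, regular_apply_of_contDiffOn hg,
    regular_apply_of_contDiffOn (hf.sub hg), 
    ← integral_sub (integrable_mul_of_contDiffOn hf φ) (integrable_mul_of_contDiffOn hg φ)]
  simp [mul_sub]

theorem contDiffOn_curl {U : Opens Plane} {f : Plane → Fin 2 → ℝ}
    (hf : ∀ i, ContDiffOn ℝ ∞ (fun x => f x i) U) : ContDiffOn ℝ ∞ (curl f) U :=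
  (contDiffOn_fderiv_apply (hf 1) _).sub (contDiffOn_fderiv_apply (hf 0) _)

theorem distCurl_regular {U : Opens Plane} {f : Plane → Fin 2 → ℝ}
    (hf : ∀ i, ContDiffOn ℝ ∞ (fun x => f x i) U) :
    distCurl (fun i => regular U fun x => f x i) = regular U (curl f) := by
  rw [distCurl, lineDerivOp_regular (hf 1), lineDerivOp_regular (hf 0),
    regular_sub (contDiffOn_fderiv_apply (hf 1) _) (contDiffOn_fderiv_apply (hf 0) _)]
  rfl

theorem distCurl_distCurlTensor_regularTensor {U : Opens Plane}
    {F : Plane → Matrix (Fin 2) (Fin 2) ℝ} (hF : ∀ i j, ContDiffOn ℝ ∞ (fun x => F x i j) U) :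
    distCurl (distCurlTensor (regularTensor U F)) = regular U (curl (curlTensor F)) := by
  have h : distCurlTensor (regularTensor U F) = fun i => regular U fun x => curlTensor F x i :=
    funext fun i => distCurl_regular (f := fun x j => F x i j) (hF i)
  rw [h]
  exact distCurl_regular fun i => contDiffOn_curl (hF i)

theorem eq_zero_of_regular_eq_zero {U : Opens Plane} {f : Plane → ℝ} (hf : ContDiffOn ℝ ∞ f U)
    (h : regular U f = 0) : ∀ x ∈ U, f x = 0 := by
  have h1 := U.isOpen.ae_eq_zero_of_integral_contDiff_smul_eq_zero
    (locallyIntegrableOn_of_contDiffOn hf) fun g hg hc hs => by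
      have h2 := regular_apply_of_contDiffOn hf (mkTest g hg hc hs)
      rw [h] at h2
      exact h2.symm
  exact Measure.eqOn_open_of_ae_eq (μ := volume) (g := fun _ => (0 : ℝ))
    ((ae_restrict_iff' U.isOpen.measurableSet).2 h1) U.isOpen hf.continuousOn continuousOn_const

/-! ### Green's theorem on an annulus -/

/-- Polar coordinates in the plane. -/
noncomputable def polarPt (p : ℝ × ℝ) : Plane := circlePt p.1 p.2

theorem polarPt_eq (p : ℝ × ℝ) :
    polarPt p = (p.1 * Real.cos p.2) • e 0 + (p.1 * Real.sin p.2) • e 1 := by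
  ext i
  fin_cases i <;> simp [polarPt, circlePt, e]

theorem norm_circlePt (r t : ℝ) : ‖circlePt r t‖ = |r| := by
  rw [EuclideanSpace.norm_eq, Fin.sum_univ_two]
  simp only [circlePt, Real.norm_eq_abs, sq_abs]
  rw [← Real.sqrt_sq_eq_abs]
  congr 1
  simp
  nlinarith [Real.sin_sq_add_cos_sq t]

/-- The derivative of polar coordinates. -/
noncomputable def polarDeriv (p : ℝ × ℝ) : ℝ × ℝ →L[ℝ] Plane :=
  (p.1 • (-Real.sin p.2 • ContinuousLinearMap.snd ℝ ℝ ℝ) +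
    Real.cos p.2 • ContinuousLinearMap.fst ℝ ℝ ℝ).smulRight (e 0) +
  (p.1 • (Real.cos p.2 • ContinuousLinearMap.snd ℝ ℝ ℝ) +
    Real.sin p.2 • ContinuousLinearMap.fst ℝ ℝ ℝ).smulRight (e 1)

theorem hasFDerivAt_polarPt (p : ℝ × ℝ) : HasFDerivAt polarPt (polarDeriv p) p := by
  have h : polarPt = fun p : ℝ × ℝ => (p.1 * Real.cos p.2) • e 0 + (p.1 * Real.sin p.2) • e 1 :=
    funext polarPt_eq
  rw [h]
  have h1 : HasFDerivAt (fun p : ℝ × ℝ => p.1) (ContinuousLinearMap.fst ℝ ℝ ℝ) p := hasFDerivAt_fst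
  have h2 : HasFDerivAt (fun p : ℝ × ℝ => p.2) (ContinuousLinearMap.snd ℝ ℝ ℝ) p := hasFDerivAt_snd
  exact ((h1.mul h2.cos).smul_const (e 0)).add ((h1.mul h2.sin).smul_const (e 1))

theorem continuous_polarPt : Continuous polarPt :=
  continuous_iff_continuousAt.2 fun p => (hasFDerivAt_polarPt p).continuousAt

theorem polarDeriv_apply_radial (p : ℝ × ℝ) :
    polarDeriv p (1, 0) = Real.cos p.2 • e 0 + Real.sin p.2 • e 1 := by
  simp [polarDeriv]

theorem polarDeriv_apply_angular (p : ℝ × ℝ) :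
    polarDeriv p (0, 1) = (-(p.1 * Real.sin p.2)) • e 0 + (p.1 * Real.cos p.2) • e 1 := by
  simp [polarDeriv]

/-- Green's theorem on the annulus `a ≤ |x| ≤ b`, in polar coordinates. -/
theorem integral_curl_annulus {U : Opens Plane} {f : Plane → Fin 2 → ℝ}
    (hf : ∀ i, ContDiffOn ℝ ∞ (fun x => f x i) U) {a b : ℝ} (ha : 0 < a) (hab : a ≤ b)
    (hU : ∀ x, a ≤ ‖x‖ → ‖x‖ ≤ b → x ∈ U) :
    ∫ p in Icc (a, -Real.pi) (b, Real.pi), p.1 * curl f (polarPt p) =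
      (∫ t in (-Real.pi)..Real.pi, (f (circlePt b t) 0 * (-(b * Real.sin t)) +
        f (circlePt b t) 1 * (b * Real.cos t))) -
      ∫ t in (-Real.pi)..Real.pi, (f (circlePt a t) 0 * (-(a * Real.sin t)) +
        f (circlePt a t) 1 * (a * Real.cos t)) := by
  set D : Fin 2 → ℝ × ℝ → ℝ × ℝ →L[ℝ] ℝ := fun i p =>
    (fderiv ℝ (fun x => f x i) (polarPt p)).comp (polarDeriv p) with hD
  -- F and -G are the angular and radial components of the 1-form f pulled back to polar
  -- coordinates, so the divergence of (F, G) is r times the curl of f.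
  set F : ℝ × ℝ → ℝ := fun p => f (polarPt p) 0 * (-(p.1 * Real.sin p.2)) +
    f (polarPt p) 1 * (p.1 * Real.cos p.2) with hF
  set G : ℝ × ℝ → ℝ := fun p => -(f (polarPt p) 0 * Real.cos p.2 +
    f (polarPt p) 1 * Real.sin p.2) with hG
  have hmem : ∀ p ∈ Icc (a, -Real.pi) (b, Real.pi), polarPt p ∈ U := fun p hp => by
    have h1 : a ≤ p.1 := hp.1.1
    have h2 : p.1 ≤ b := hp.2.1
    have h3 : ‖polarPt p‖ = p.1 := by rw [polarPt, norm_circlePt, abs_of_pos (ha.trans_le h1)]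
    exact hU _ (by rw [h3]; exact h1) (by rw [h3]; exact h2)
  have hd : ∀ p ∈ Icc (a, -Real.pi) (b, Real.pi), ∀ i,
      HasFDerivAt (fun p => f (polarPt p) i) (D i p) p := fun p hp i =>
    HasFDerivAt.comp (g := fun x => f x i) p
      (differentiableAt_of_contDiffOn (hf i) (hmem p hp)).hasFDerivAt (hasFDerivAt_polarPt p)
  have h1 (p : ℝ × ℝ) : HasFDerivAt (fun p : ℝ × ℝ => p.1) (ContinuousLinearMap.fst ℝ ℝ ℝ) p :=
    hasFDerivAt_fst
  have h2 (p : ℝ × ℝ) : HasFDerivAt (fun p : ℝ × ℝ => p.2) (ContinuousLinearMap.snd ℝ ℝ ℝ) p :=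
    hasFDerivAt_snd
  have hsub : Ioo a b ×ˢ Ioo (-Real.pi) Real.pi ⊆ Icc (a, -Real.pi) (b, Real.pi) := by
    rw [Icc_prod_eq]
    exact prod_mono Ioo_subset_Icc_self Ioo_subset_Icc_self
  have hFd : ∀ p ∈ Icc (a, -Real.pi) (b, Real.pi), HasFDerivAt F _ p := fun p hp =>
    ((hd p hp 0).mul ((h1 p).mul (h2 p).sin).neg).add ((hd p hp 1).mul ((h1 p).mul (h2 p).cos))
  have hGd : ∀ p ∈ Icc (a, -Real.pi) (b, Real.pi), HasFDerivAt G _ p := fun p hp =>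
    (((hd p hp 0).mul (h2 p).cos).add ((hd p hp 1).mul (h2 p).sin)).neg
  have hdiv := integral_divergence_prod_Icc_of_hasFDerivAt_of_le F G _ _
    (a, -Real.pi) (b, Real.pi) ⟨hab, by linarith [Real.pi_pos]⟩
    (fun p hp => (hFd p hp).continuousAt.continuousWithinAt)
    (fun p hp => (hGd p hp).continuousAt.continuousWithinAt)
    (fun p hp => hFd p (hsub hp)) (fun p hp => hGd p (hsub hp))
  -- The right-hand side has the form that the product rules in `hFd` and `hGd` produce.
  -- Undifferentiated terms in f cancel, as do the symmetric derivative terms.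
  have heq : ∀ p : ℝ × ℝ, p.1 * curl f (polarPt p) =
      (f (polarPt p) 0 • -(p.1 • Real.cos p.2 • ContinuousLinearMap.snd ℝ ℝ ℝ +
        Real.sin p.2 • ContinuousLinearMap.fst ℝ ℝ ℝ) +
        (-(p.1 * Real.sin p.2)) • D 0 p +
      (f (polarPt p) 1 • (p.1 • -Real.sin p.2 • ContinuousLinearMap.snd ℝ ℝ ℝ +
        Real.cos p.2 • ContinuousLinearMap.fst ℝ ℝ ℝ) +
        (p.1 * Real.cos p.2) • D 1 p)) (1, 0) +
      (-(f (polarPt p) 0 • -Real.sin p.2 • ContinuousLinearMap.snd ℝ ℝ ℝ +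
        Real.cos p.2 • D 0 p +
      (f (polarPt p) 1 • Real.cos p.2 • ContinuousLinearMap.snd ℝ ℝ ℝ +
        Real.sin p.2 • D 1 p))) (0, 1) := fun p => by
    simp only [hD, add_apply, neg_apply,
      smul_apply, ContinuousLinearMap.comp_apply, polarDeriv_apply_radial,
      polarDeriv_apply_angular, map_add, map_smul, smul_eq_mul, ContinuousLinearMap.coe_fst',
      ContinuousLinearMap.coe_snd', curl]
    linear_combination (-p.1 * fderiv ℝ (fun x => f x 1) (polarPt p) (e 0) +
      p.1 * fderiv ℝ (fun x => f x 0) (polarPt p) (e 1)) * Real.sin_sq_add_cos_sq p.2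
  have hint : IntegrableOn (fun p : ℝ × ℝ => p.1 * curl f (polarPt p))
      (Icc (a, -Real.pi) (b, Real.pi)) :=
    (continuous_fst.continuousOn.mul ((contDiffOn_curl hf).continuousOn.comp
      continuous_polarPt.continuousOn hmem)).integrableOn_compact isCompact_Icc
  refine (setIntegral_congr_fun measurableSet_Icc fun p _ => heq p).trans ((hdiv ?_).trans ?_)
  · exact hint.congr_fun (fun p _ => heq p) measurableSet_Icc
  · have hper : ∀ r, G (r, Real.pi) = G (r, -Real.pi) := fun r => by
      have : polarPt (r, -Real.pi) = polarPt (r, Real.pi) := by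
        rw [polarPt_eq, polarPt_eq]
        simp
      simp only [hG, this]
      simp
    simp only [hper, sub_self, zero_add]
    rfl

theorem integral_eq_integral_polar (f : Plane → ℝ) :
    ∫ x, f x = ∫ p in Ioi (0 : ℝ) ×ˢ Ioo (-Real.pi) Real.pi, p.1 * f (polarPt p) := by
  have h1 := (EuclideanSpace.volume_preserving_symm_measurableEquiv_toLp (Fin 2)).symm.integral_comp'
    (g := f)
  have h2 := (volume_preserving_finTwoArrow ℝ).symm.integral_comp'
    (g := fun x : Fin 2 → ℝ => f (WithLp.toLp 2 x))
  have h3 := integral_comp_polarCoord_symm fun p : ℝ × ℝ => f (WithLp.toLp 2 ![p.1, p.2])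
  rw [← h1]
  refine Eq.trans h2.symm ?_
  refine Eq.trans h3.symm ?_
  rfl

theorem setIntegral_polar_eq_Icc {G : ℝ × ℝ → ℝ} {a b : ℝ} (ha : 0 < a)
    (h0 : ∀ p : ℝ × ℝ, 0 < p.1 → p.1 ≤ a ∨ b ≤ p.1 → G p = 0) :
    ∫ p in Ioi (0 : ℝ) ×ˢ Ioo (-Real.pi) Real.pi, G p =
      ∫ p in Icc (a, -Real.pi) (b, Real.pi), G p := by
  have hsub : Ioo a b ×ˢ Ioo (-Real.pi) Real.pi ⊆ Ioi (0 : ℝ) ×ˢ Ioo (-Real.pi) Real.pi :=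
    prod_mono (fun x hx => ha.trans hx.1) le_rfl
  rw [setIntegral_eq_of_subset_of_forall_sdiff_eq_zero
    (measurableSet_Ioi.prod measurableSet_Ioo) hsub fun p hp => h0 p hp.1.1 ?_, Icc_prod_eq]
  · refine setIntegral_congr_set ?_
    rw [Measure.volume_eq_prod]
    exact Measure.set_prod_ae_eq Ioo_ae_eq_Icc Ioo_ae_eq_Icc
  · by_contra! h
    exact hp.2 ⟨h, hp.1.2⟩

/-- The integral of `dχ ∧ f` for a closed form `f` on a punctured disc and a cutoff function `χ` is,
up to sign, the period of `f`. -/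
theorem integral_fderiv_cutoff_eq_neg_loop {U : Opens Plane} {f : Plane → Fin 2 → ℝ}
    (hf : ∀ i, ContDiffOn ℝ ∞ (fun x => f x i) U) (hcurl : ∀ x ∈ U, curl f x = 0) {ε r₁ r₂ : ℝ}
    (hr₁ : 0 < r₁) (hr₁ε : r₁ < ε) (hr₂ : r₂ < ε) (hU : ∀ x, x ≠ 0 → ‖x‖ ≤ ε → x ∈ U)
    {χ : Plane → ℝ} (hχ : ContDiff ℝ ∞ χ) (hχ1 : ∀ x, ‖x‖ ≤ r₁ → χ x = 1)
    (hχ0 : ∀ x, r₂ ≤ ‖x‖ → χ x = 0) :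
    ∫ x, (fderiv ℝ χ x (e 0) * f x 1 - fderiv ℝ χ x (e 1) * f x 0) =
      -∫ t in (0 : ℝ)..(2 * Real.pi), (f (circlePt ε t) 0 * (-(ε * Real.sin t)) +
        f (circlePt ε t) 1 * (ε * Real.cos t)) := by
  have hε : 0 < ε := hr₁.trans hr₁ε
  have hpos : ∀ x : Plane, r₁ / 2 ≤ ‖x‖ → x ≠ 0 := fun x hx h0 => by
    rw [h0, norm_zero] at hx
    linarith
  have hf1 : ∀ x, ‖x‖ < r₁ → fderiv ℝ χ x = 0 := fun x hx => by
    have : χ =ᶠ[𝓝 x] fun _ => 1 := by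
      filter_upwards [(isOpen_ball (x := (0 : Plane)) (ε := r₁)).mem_nhds
        (mem_ball_zero_iff.2 hx)] with y hy
      exact hχ1 y (mem_ball_zero_iff.1 hy).le
    rw [this.fderiv_eq, fderiv_fun_const]
    rfl
  have hf0 : ∀ x, r₂ < ‖x‖ → fderiv ℝ χ x = 0 := fun x hx => by
    have : χ =ᶠ[𝓝 x] fun _ => 0 := by
      filter_upwards [(isOpen_lt continuous_const continuous_norm).mem_nhds hx] with y hy
      exact hχ0 y (le_of_lt hy)
    rw [this.fderiv_eq, fderiv_fun_const]
    rfl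
  -- Since f is closed, curl W = dχ ∧ f. Using χ - 1 instead of χ makes W vanish on the inner circle
  -- and equal -f on the outer one, whence the sign.
  set W : Plane → Fin 2 → ℝ := fun x i => (χ x - 1) * f x i with hW
  have hWs : ∀ i, ContDiffOn ℝ ∞ (fun x => W x i) U := fun i =>
    (hχ.sub contDiff_const).contDiffOn.mul (hf i)
  have hcW : ∀ x ∈ U, curl W x =
      fderiv ℝ χ x (e 0) * f x 1 - fderiv ℝ χ x (e 1) * f x 0 := fun x hx => by
    have hd : ∀ i, fderiv ℝ (fun y => W y i) x =
        (χ x - 1) • fderiv ℝ (fun y => f y i) x + f x i • fderiv ℝ χ x := fun i => by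
      have hχd : DifferentiableAt ℝ (fun y => χ y - 1) x :=
        ((hχ.differentiable (by simp)).sub_const 1) x
      rw [fderiv_fun_mul hχd (differentiableAt_of_contDiffOn (hf i) hx), fderiv_sub_const]
    have h0 := hcurl x hx
    simp only [curl, hd, add_apply, smul_apply, smul_eq_mul] at h0 ⊢
    linear_combination (χ x - 1) * h0
  have hgreen := integral_curl_annulus hWs (half_pos hr₁) (by linarith : r₁ / 2 ≤ ε)
    fun x h1 h2 => hU x (hpos x h1) h2
  have hloop0 : (∫ t in (-Real.pi)..Real.pi, (W (circlePt (r₁ / 2) t) 0 *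
      (-(r₁ / 2 * Real.sin t)) + W (circlePt (r₁ / 2) t) 1 * (r₁ / 2 * Real.cos t))) = 0 := by
    have : ∀ t, χ (circlePt (r₁ / 2) t) = 1 := fun t =>
      hχ1 _ (by rw [norm_circlePt, abs_of_pos (by linarith)]; linarith)
    simp [hW, this]
  have hloopε : ∀ t i, W (circlePt ε t) i = -f (circlePt ε t) i := fun t i => by
    simp only [hW]
    rw [hχ0 _ (by rw [norm_circlePt, abs_of_pos hε]; exact hr₂.le)]
    ring
  rw [hloop0, sub_zero] at hgreen
  simp only [hloopε] at hgreen
  rw [integral_eq_integral_polar, setIntegral_polar_eq_Icc (half_pos hr₁) (b := ε) fun p hp h => ?_]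
  · rw [setIntegral_congr_fun (g := fun p : ℝ × ℝ => p.1 * curl W (polarPt p)) measurableSet_Icc
      fun p hp => ?_, hgreen]
    · have hper : Function.Periodic (fun t => f (circlePt ε t) 0 * (-(ε * Real.sin t)) +
          f (circlePt ε t) 1 * (ε * Real.cos t)) (2 * Real.pi) := fun t => by
        simp [circlePt]
      have h1 := hper.intervalIntegral_add_eq (-Real.pi) 0
      rw [zero_add, show -Real.pi + 2 * Real.pi = Real.pi by ring] at h1
      rw [← h1, ← intervalIntegral.integral_neg]
      refine intervalIntegral.integral_congr fun t _ => ?_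
      ring
    · have h1 : r₁ / 2 ≤ p.1 := hp.1.1
      have h2 : p.1 ≤ ε := hp.2.1
      have h3 : ‖polarPt p‖ = p.1 := by
        rw [polarPt, norm_circlePt, abs_of_pos (by linarith)]
      beta_reduce
      rw [hcW _ (hU _ (hpos _ (by rw [h3]; exact h1)) (by rw [h3]; exact h2))]
  · have h3 : ‖polarPt p‖ = p.1 := by rw [polarPt, norm_circlePt, abs_of_pos hp]
    have : fderiv ℝ χ (polarPt p) = 0 := by
      rcases h with h | h
      · exact hf1 _ (by rw [h3]; linarith)
      · exact hf0 _ (by rw [h3]; linarith)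
    simp [this]

/-! ### The Cesàro integral as the value of the incompatibility on cut off affine functions -/

/-- The affine function `c + a · x`. -/
noncomputable def aff (a : Fin 2 → ℝ) (c : ℝ) (x : Plane) : ℝ := c + a 0 * x 0 + a 1 * x 1

theorem contDiff_coord (i : Fin 2) : ContDiff ℝ ∞ fun x : Plane => x i :=
  (EuclideanSpace.proj i : Plane →L[ℝ] ℝ).contDiff

theorem contDiff_aff (a : Fin 2 → ℝ) (c : ℝ) : ContDiff ℝ ∞ (aff a c) :=
  (contDiff_const.add (contDiff_const.mul (contDiff_coord 0))).add
    (contDiff_const.mul (contDiff_coord 1))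

theorem fderiv_aff (a : Fin 2 → ℝ) (c : ℝ) (x : Plane) (i : Fin 2) :
    fderiv ℝ (aff a c) x (e i) = a i := by
  have h (j : Fin 2) : HasFDerivAt (fun x : Plane => x j) (EuclideanSpace.proj j : Plane →L[ℝ] ℝ) x :=
    (EuclideanSpace.proj j : Plane →L[ℝ] ℝ).hasFDerivAt
  have h1 : HasFDerivAt (aff a c) (a 0 • (EuclideanSpace.proj 0 : Plane →L[ℝ] ℝ) +
      a 1 • (EuclideanSpace.proj 1 : Plane →L[ℝ] ℝ)) x :=
    (((h 0).const_mul (a 0)).const_add c).add ((h 1).const_mul (a 1))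
  rw [h1.fderiv]
  fin_cases i <;> simp [e]

theorem lineDerivOp_mulTest {Ω : Opens Plane} {h : Plane → ℝ} (hh : ContDiff ℝ ∞ h) (φ : 𝓓(Ω, ℝ))
    (v x : Plane) : (∂_{v} (mulTest h hh φ) : 𝓓(Ω, ℝ)) x =
      h x * (∂_{v} φ : 𝓓(Ω, ℝ)) x + fderiv ℝ h x v * φ x := by
  rw [lineDerivOp_test_apply, lineDerivOp_test_apply,
    show ⇑(mulTest h hh φ) = fun x => h x * φ x from rfl,
    fderiv_fun_mul (hh.differentiable (by simp) x) ((smooth φ).differentiable (by simp) x)]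
  simp [mul_comm]

theorem lineDerivOp_mulTest_aff {Ω : Opens Plane} (a : Fin 2 → ℝ) (c : ℝ) (φ : 𝓓(Ω, ℝ))
    (i : Fin 2) : ∂_{e i} (mulTest (aff a c) (contDiff_aff a c) φ) =
      mulTest (aff a c) (contDiff_aff a c) (∂_{e i} φ) + a i • φ := by
  ext x
  rw [lineDerivOp_mulTest, fderiv_aff]
  rfl

/-- The field `a₀ E₁ - a₁ E₀ - (c + a · x) curl E`, whose circulation is a component of the
Cesàro integral. -/
noncomputable def cesaroField (a : Fin 2 → ℝ) (c : ℝ) (F : Plane → Matrix (Fin 2) (Fin 2) ℝ)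
    (x : Plane) (j : Fin 2) : ℝ :=
  -(aff a c x * curlTensor F x j) + a 0 * F x 1 j - a 1 * F x 0 j

section

variable {U : Opens Plane} {F : Plane → Matrix (Fin 2) (Fin 2) ℝ}

theorem contDiffOn_curlTensor (hF : ∀ i j, ContDiffOn ℝ ∞ (fun x => F x i j) U) (i : Fin 2) :
    ContDiffOn ℝ ∞ (fun x => curlTensor F x i) U :=
  contDiffOn_curl (hF i)

theorem contDiffOn_cesaroField (hF : ∀ i j, ContDiffOn ℝ ∞ (fun x => F x i j) U) (a : Fin 2 → ℝ)
    (c : ℝ) (j : Fin 2) : ContDiffOn ℝ ∞ (fun x => cesaroField a c F x j) U :=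
  (((contDiff_aff a c).contDiffOn.mul (contDiffOn_curlTensor hF j)).neg.add
    (contDiffOn_const.mul (hF 1 j))).sub (contDiffOn_const.mul (hF 0 j))

/-- The product-rule terms a₀ (curl F)₁ - a₁ (curl F)₀ cancel against the curls of the two row
terms, so the field is closed wherever curl curl F = 0. -/
theorem curl_cesaroField (hF : ∀ i j, ContDiffOn ℝ ∞ (fun x => F x i j) U) (a : Fin 2 → ℝ)
    (c : ℝ) {x : Plane} (hx : x ∈ U) :
    curl (cesaroField a c F) x = -(aff a c x * curl (curlTensor F) x) := by
  have hd : ∀ j, HasFDerivAt (fun y => cesaroField a c F y j)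
      (-(aff a c x • fderiv ℝ (fun y => curlTensor F y j) x +
        curlTensor F x j • fderiv ℝ (aff a c) x) + a 0 • fderiv ℝ (fun y => F y 1 j) x -
        a 1 • fderiv ℝ (fun y => F y 0 j) x) x := fun j =>
    (((((contDiff_aff a c).differentiable (by simp) x).hasFDerivAt.mul
      (differentiableAt_of_contDiffOn (contDiffOn_curlTensor hF j) hx).hasFDerivAt).neg).add
      ((differentiableAt_of_contDiffOn (hF 1 j) hx).hasFDerivAt.const_mul (a 0))).sub
      ((differentiableAt_of_contDiffOn (hF 0 j) hx).hasFDerivAt.const_mul (a 1))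
  have hc : ∀ i, curlTensor F x i =
    fderiv ℝ (fun y => F y i 1) x (e 0) - fderiv ℝ (fun y => F y i 0) x (e 1) := fun i => rfl
  rw [curl, (hd 1).fderiv, (hd 0).fderiv, curl]
  simp only [sub_apply, add_apply, neg_apply, smul_apply, smul_eq_mul, fderiv_aff]
  rw [hc 0, hc 1]
  ring

theorem regular_cesaroField (hF : ∀ i j, ContDiffOn ℝ ∞ (fun x => F x i j) U) (a : Fin 2 → ℝ)
    (c : ℝ) (j : Fin 2) (φ : 𝓓(U, ℝ)) :
    regular U (fun x => cesaroField a c F x j) φ =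
      -regular U (fun x => curlTensor F x j) (mulTest (aff a c) (contDiff_aff a c) φ) +
        a 0 * regular U (fun x => F x 1 j) φ - a 1 * regular U (fun x => F x 0 j) φ := by
  have h1 := integrable_mul_of_contDiffOn (contDiffOn_curlTensor hF j)
    (mulTest (aff a c) (contDiff_aff a c) φ)
  have h2 := (integrable_mul_of_contDiffOn (hF 1 j) φ).const_mul (a 0)
  have h3 := (integrable_mul_of_contDiffOn (hF 0 j) φ).const_mul (a 1)
  have h4 : Integrable fun x => -(mulTest (aff a c) (contDiff_aff a c) φ x * curlTensor F x j) :=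
    h1.neg
  have h5 : Integrable fun x => -(mulTest (aff a c) (contDiff_aff a c) φ x * curlTensor F x j) +
      a 0 * (φ x * F x 1 j) := h4.add h2
  rw [regular_apply_of_contDiffOn (contDiffOn_cesaroField hF a c j),
    regular_apply_of_contDiffOn (contDiffOn_curlTensor hF j),
    regular_apply_of_contDiffOn (hF 1 j), regular_apply_of_contDiffOn (hF 0 j),
    ← integral_const_mul, ← integral_const_mul, ← integral_neg, ← integral_add h4 h2,
    ← integral_sub h5 h3]
  refine integral_congr_ae (Eventually.of_forall fun x => ?_)
  simp only [cesaroField, mulTest_apply]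
  ring

end

theorem IsExtension.apply_monoCLM {Ω : Opens Plane} {E : TensorDistribution Ω}
    {F : Plane → Matrix (Fin 2) (Fin 2) ℝ} (hE : IsExtension E (regularTensor (punctured Ω) F))
    (i j : Fin 2) (φ : 𝓓(punctured Ω, ℝ)) :
    E i j (TestFunction.monoCLM ℝ φ) = regular (punctured Ω) (fun x => F x i j) φ :=
  congrArg (fun T : 𝓓'(punctured Ω, ℝ) => T φ) (hE i j)

theorem monoCLM_mulTest {U Ω : Opens Plane} (hle : U ≤ Ω) {h : Plane → ℝ} (hh : ContDiff ℝ ∞ h)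
    (φ : 𝓓(U, ℝ)) : (TestFunction.monoCLM ℝ (mulTest h hh φ) : 𝓓(Ω, ℝ)) =
      mulTest h hh (TestFunction.monoCLM ℝ φ) := by
  ext x
  rw [monoCLM_test_apply hle, mulTest_apply, mulTest_apply, monoCLM_test_apply hle]

/-- With ℓ affine, ∂_i∂_j(ℓχ) = ∂_i(ℓ ∂_jχ) + a_j ∂_iχ: every term contains a derivative of χ and so
avoids the origin, where the choice of extension matters. The value is thus computed from F alone.
-/
theorem distCurl_distCurlTensor_mulTest_aff {Ω : Opens Plane} {E : TensorDistribution Ω}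
    {F : Plane → Matrix (Fin 2) (Fin 2) ℝ}
    (hF : ∀ i j, ContDiffOn ℝ ∞ (fun x => F x i j) (punctured Ω))
    (hE : IsExtension E (regularTensor (punctured Ω) F)) (a : Fin 2 → ℝ) (c : ℝ) (χ : 𝓓(Ω, ℝ))
    (hχ : ∀ i, (0 : Plane) ∉ tsupport (∂_{e i} χ : 𝓓(Ω, ℝ))) :
    distCurl (distCurlTensor E) (mulTest (aff a c) (contDiff_aff a c) χ) =
      ∫ x, (fderiv ℝ χ x (e 0) * cesaroField a c F x 1 -
        fderiv ℝ χ x (e 1) * cesaroField a c F x 0) := by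
  have hle := punctured_le Ω
  obtain ⟨b, hb⟩ : ∃ b : Fin 2 → 𝓓(punctured Ω, ℝ), ∀ i, ∂_{e i} χ = TestFunction.monoCLM ℝ (b i) :=
    ⟨fun i => toPunctured _ (hχ i), fun i => (monoCLM_toPunctured _ (hχ i)).symm⟩
  have hbx : ∀ i x, b i x = fderiv ℝ χ x (e i) := fun i x => by
    rw [← lineDerivOp_test_apply, hb, monoCLM_test_apply hle]
  set ℓ : 𝓓(punctured Ω, ℝ) →ₗ[ℝ] 𝓓(punctured Ω, ℝ) := mulTest (aff a c) (contDiff_aff a c) with hℓ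
  have h2 : ∀ i j, ∂_{e i} (∂_{e j} (mulTest (aff a c) (contDiff_aff a c) χ)) =
      TestFunction.monoCLM ℝ (∂_{e i} (ℓ (b j)) + a j • b i) := fun i j => by
    rw [lineDerivOp_mulTest_aff, LineDeriv.lineDerivOp_add, LineDeriv.lineDerivOp_smul, map_add,
      map_smul, hb, hb, ← lineDerivOp_monoCLM hle, hℓ, monoCLM_mulTest hle]
  -- Moving the outer derivative in ∂_i(ℓ ∂_jχ) onto F produces `curlTensor F`.
  have hcurl : ∀ i (φ : 𝓓(punctured Ω, ℝ)),
      regular (punctured Ω) (fun x => F x i 1) (∂_{e 0} φ) -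
        regular (punctured Ω) (fun x => F x i 0) (∂_{e 1} φ) =
      -regular (punctured Ω) (fun x => curlTensor F x i) φ := fun i φ => by
    have h := congrArg (fun T : 𝓓'(punctured Ω, ℝ) => T φ)
      (distCurl_regular (f := fun x j => F x i j) (hF i))
    have hsub (T S : 𝓓'(punctured Ω, ℝ)) : (T - S) φ = T φ - S φ := rfl
    simp only [distCurl, hsub, Distribution.lineDerivOp_apply_apply, map_neg] at h
    change _ = -regular (punctured Ω) (curl fun x j => F x i j) φ
    linarith
  have h0 := hcurl 0 (ℓ (b 1))
  have h1 := hcurl 1 (ℓ (b 0))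
  have hV := contDiffOn_cesaroField hF a c
  have hint : ∫ x, (fderiv ℝ χ x (e 0) * cesaroField a c F x 1 -
        fderiv ℝ χ x (e 1) * cesaroField a c F x 0) =
      regular (punctured Ω) (fun x => cesaroField a c F x 1) (b 0) -
        regular (punctured Ω) (fun x => cesaroField a c F x 0) (b 1) := by
    rw [regular_apply_of_contDiffOn (hV 1), regular_apply_of_contDiffOn (hV 0),
      ← integral_sub (integrable_mul_of_contDiffOn (hV 1) _)
        (integrable_mul_of_contDiffOn (hV 0) _)]
    simp only [hbx]
  rw [hint, regular_cesaroField hF, regular_cesaroField hF, distCurl_distCurlTensor_apply]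
  simp only [h2, hE.apply_monoCLM, map_add, map_smul, smul_eq_mul]
  linarith

/-- The circulation of a vector field along a circle. -/
noncomputable def circulation (ε : ℝ) (f : Plane → Fin 2 → ℝ) : ℝ :=
  ∫ t in (0 : ℝ)..(2 * Real.pi), (f (circlePt ε t) 0 * (-(ε * Real.sin t)) +
    f (circlePt ε t) 1 * (ε * Real.cos t))

theorem cesaroIntegrand_apply (F : Plane → Matrix (Fin 2) (Fin 2) ℝ) (x y : Plane) (i j : Fin 2) :
    cesaroIntegrand F x y i j = F y i j + ![y 1 - x 1, -(y 0 - x 0)] i * curlTensor F y j := rfl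

/-- Because v × c has rows v₁c and -v₀c (indices from 0), the two components of the Cesàro integral
correspond to the affine functions y₁ - x₁ and y₀ - x₀, with opposite signs. -/
theorem loopIntegral_cesaroIntegrand_zero (ε : ℝ) (F : Plane → Matrix (Fin 2) (Fin 2) ℝ)
    (x : Plane) : loopIntegral ε (cesaroIntegrand F x) 0 =
      -circulation ε (cesaroField ![0, 1] (-x 1) F) := by
  rw [circulation, ← intervalIntegral.integral_neg]
  refine intervalIntegral.integral_congr fun t _ => ?_
  simp [cesaroIntegrand_apply, cesaroField, aff]
  ring

theorem loopIntegral_cesaroIntegrand_one (ε : ℝ) (F : Plane → Matrix (Fin 2) (Fin 2) ℝ)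
    (x : Plane) : loopIntegral ε (cesaroIntegrand F x) 1 =
      circulation ε (cesaroField ![1, 0] (-x 0) F) := by
  refine intervalIntegral.integral_congr fun t _ => ?_
  simp [cesaroIntegrand_apply, cesaroField, aff]
  ring

/-- A cutoff function at the origin, supported in a ball of radius less than `ε`. -/
noncomputable def cutoff (ε : ℝ) (hε : 0 < ε) : ContDiffBump (0 : Plane) :=
  ⟨ε / 4, ε / 2, by positivity, by linarith⟩

/-- A cutoff function at the origin, as a test function. -/
noncomputable def cutoffTest {Ω : Opens Plane} {ε : ℝ} (hε : 0 < ε)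
    (hball : closedBall (0 : Plane) ε ⊆ Ω) : 𝓓(Ω, ℝ) :=
  mkTest (cutoff ε hε) (cutoff ε hε).contDiff (cutoff ε hε).hasCompactSupport (by
    rw [(cutoff ε hε).tsupport_eq]
    exact (closedBall_subset_closedBall (by change ε / 2 ≤ ε; linarith)).trans hball)

theorem cutoff_eventuallyEq_one {ε : ℝ} (hε : 0 < ε) : cutoff ε hε =ᶠ[𝓝 0] fun _ => 1 := by
  filter_upwards [closedBall_mem_nhds (0 : Plane) (cutoff ε hε).rIn_pos] with x hx
  exact (cutoff ε hε).one_of_mem_closedBall hx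

theorem zero_notMem_tsupport_lineDerivOp_cutoffTest {Ω : Opens Plane} {ε : ℝ} (hε : 0 < ε)
    (hball : closedBall (0 : Plane) ε ⊆ Ω) (v : Plane) :
    (0 : Plane) ∉ tsupport (∂_{v} (cutoffTest hε hball) : 𝓓(Ω, ℝ)) := by
  rw [notMem_tsupport_iff_eventuallyEq]
  filter_upwards [(cutoff_eventuallyEq_one hε).eventuallyEq_nhds] with x hx
  rw [lineDerivOp_test_apply]
  change fderiv ℝ (cutoff ε hε) x v = 0
  rw [hx.fderiv_eq, fderiv_fun_const]
  rfl

/-- The link between the two sides of the theorem: the pairing is an integral of dχ ∧ f with f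
closed off the origin, hence a period of f. -/
theorem distCurl_distCurlTensor_cutoff_aff {Ω : Opens Plane} {E : TensorDistribution Ω}
    {F : Plane → Matrix (Fin 2) (Fin 2) ℝ}
    (hF : ∀ i j, ContDiffOn ℝ ∞ (fun x => F x i j) (punctured Ω))
    (hE : IsExtension E (regularTensor (punctured Ω) F))
    (hcurl : ∀ x ∈ punctured Ω, curl (curlTensor F) x = 0) {ε : ℝ} (hε : 0 < ε)
    (hball : closedBall (0 : Plane) ε ⊆ Ω) (a : Fin 2 → ℝ) (c : ℝ) :
    distCurl (distCurlTensor E)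
      (mulTest (aff a c) (contDiff_aff a c) (cutoffTest hε hball)) =
      -circulation ε (cesaroField a c F) := by
  rw [distCurl_distCurlTensor_mulTest_aff hF hE a c _ fun i =>
    zero_notMem_tsupport_lineDerivOp_cutoffTest hε hball (e i)]
  exact integral_fderiv_cutoff_eq_neg_loop (U := punctured Ω) (r₁ := ε / 4) (r₂ := ε / 2)
    (contDiffOn_cesaroField hF a c)
    (fun x hx => by rw [curl_cesaroField hF a c hx, hcurl x hx, mul_zero, neg_zero])
    (by positivity) (by linarith) (by linarith)
    (fun x h0 hx => ⟨hball (by simpa using hx), h0⟩) (cutoff ε hε).contDiff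
    (fun x hx => (cutoff ε hε).one_of_mem_closedBall (mem_closedBall_zero_iff.2 hx))
    (fun x hx => (cutoff ε hε).zero_of_le_dist ((dist_zero_right x).symm ▸ hx))

/-! ### Distributions of finite order near the origin -/

/-- A distribution on `Ω` has finite order near the origin: on test functions supported in some
ball about the origin it is bounded by a `C^m` norm. -/
def FiniteOrderAtZero {Ω : Opens Plane} (T : 𝓓'(Ω, ℝ)) : Prop :=
  ∃ (δ C : ℝ) (m : ℕ), 0 < δ ∧ 0 ≤ C ∧
    ∀ φ : 𝓓(Ω, ℝ), tsupport φ ⊆ closedBall 0 δ → |T φ| ≤ C * cNorm m φ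

theorem cNorm_mono {Ω : Opens Plane} {m n : ℕ} (h : m ≤ n) (φ : 𝓓(Ω, ℝ)) :
    cNorm m φ ≤ cNorm n φ :=
  Finset.sum_le_sum_of_subset_of_nonneg (Finset.range_mono (by lia)) fun _ _ _ =>
    apply_nonneg _ _

theorem cNorm_lineDerivOp_le {Ω : Opens Plane} (m : ℕ) (φ : 𝓓(Ω, ℝ)) (v : Plane) :
    cNorm m (∂_{v} φ : 𝓓(Ω, ℝ)) ≤ (m + 1) * (‖v‖ * cNorm (m + 1) φ) := by
  refine cNorm_le (mul_nonneg (norm_nonneg _) (cNorm_nonneg _ _)) fun i hi x => ?_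
  rw [coe_lineDerivOp_test]
  refine (norm_iteratedFDeriv_clm_apply_const (N := ∞)
    ((smooth φ).fderiv_right (m := ∞) (by simp)).contDiffAt (by exact_mod_cast le_top)).trans ?_
  rw [norm_iteratedFDeriv_fderiv]
  exact mul_le_mul_of_nonneg_left (norm_iteratedFDeriv_le_cNorm (by lia) φ x) (norm_nonneg _)

theorem FiniteOrderAtZero.sub {Ω : Opens Plane} {T S : 𝓓'(Ω, ℝ)} (hT : FiniteOrderAtZero T)
    (hS : FiniteOrderAtZero S) : FiniteOrderAtZero (T - S) := by
  obtain ⟨δ, C, m, hδ, hC, h⟩ := hT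
  obtain ⟨δ', C', m', hδ', hC', h'⟩ := hS
  refine ⟨min δ δ', C + C', max m m', lt_min hδ hδ', add_nonneg hC hC', fun φ hφ => ?_⟩
  have h1 := h φ (hφ.trans (closedBall_subset_closedBall (min_le_left _ _)))
  have h2 := h' φ (hφ.trans (closedBall_subset_closedBall (min_le_right _ _)))
  have h3 := mul_le_mul_of_nonneg_left (cNorm_mono (le_max_left m m') φ) hC
  have h4 := mul_le_mul_of_nonneg_left (cNorm_mono (le_max_right m m') φ) hC'
  change |T φ - S φ| ≤ _
  linarith [abs_sub (T φ) (S φ)]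

theorem FiniteOrderAtZero.lineDerivOp {Ω : Opens Plane} {T : 𝓓'(Ω, ℝ)} (hT : FiniteOrderAtZero T)
    (v : Plane) : FiniteOrderAtZero (∂_{v} T) := by
  obtain ⟨δ, C, m, hδ, hC, h⟩ := hT
  refine ⟨δ, C * ((m + 1) * ‖v‖), m + 1, hδ, by positivity, fun φ hφ => ?_⟩
  rw [Distribution.lineDerivOp_apply_apply, map_neg, abs_neg, mul_assoc, mul_assoc]
  exact (h _ ((tsupport_lineDerivOp_subset φ v).trans hφ)).trans
    (mul_le_mul_of_nonneg_left (cNorm_lineDerivOp_le m φ v) hC)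

theorem FiniteOrderAtZero.distCurl_distCurlTensor {Ω : Opens Plane} {E : TensorDistribution Ω}
    (h : ∀ i j, FiniteOrderAtZero (E i j)) :
    FiniteOrderAtZero (distCurl (distCurlTensor E)) := by
  have h1 (i : Fin 2) : FiniteOrderAtZero (distCurlTensor E i) :=
    ((h i 1).lineDerivOp _).sub ((h i 0).lineDerivOp _)
  exact ((h1 1).lineDerivOp _).sub ((h1 0).lineDerivOp _)

/-- A distribution supported at the origin and of finite order vanishes on test functions that
vanish to sufficiently high order there. -/
theorem FiniteOrderAtZero.exists_order {Ω : Opens Plane} {T : 𝓓'(Ω, ℝ)}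
    (hT : FiniteOrderAtZero T)
    (h0 : ∀ φ : 𝓓(punctured Ω, ℝ), T (TestFunction.monoCLM ℝ φ) = 0) :
    ∃ m : ℕ, ∀ φ : 𝓓(Ω, ℝ), (∀ j ≤ m, iteratedFDeriv ℝ j φ 0 = 0) → T φ = 0 := by
  obtain ⟨δ, C, m, hδ, hC, h⟩ := hT
  refine ⟨m, fun φ hφ => ?_⟩
  let η : ContDiffBump (0 : Plane) := ⟨1 / 2, 1, by norm_num, by norm_num⟩
  have hη : ContDiff ℝ ∞ η := η.contDiff
  obtain ⟨C₁, hC₁, h1⟩ := exists_bound_iteratedFDeriv_mul_comp_smul (M := m) (m := m + 1) hη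
    η.hasCompactSupport η.tsupport_eq.subset m.le_succ
  have hφ0 : ∀ j < m + 1, iteratedFDeriv ℝ j φ 0 = 0 := fun j hj => hφ j (Nat.lt_succ_iff.1 hj)
  set A := cNorm (m + 1) φ
  have hA : ∀ x, ‖iteratedFDeriv ℝ (m + 1) φ x‖ ≤ A := norm_iteratedFDeriv_le_cNorm le_rfl φ
  have hA0 : 0 ≤ A := cNorm_nonneg _ _
  -- Cutting φ off at scale s does not change T φ, since T is supported at the origin. The i-th
  -- derivative of the cutoff function is O(s^{m+1-i}), so for i ≤ m the C^m norm is O(s); then s →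
  -- 0.
  have key : ∀ s : ℝ, 0 < s → s ≤ 1 → s ≤ δ → |T φ| ≤ C * ((m + 1) * (C₁ * A)) * s := by
    intro s hs hs1 hsδ
    have hηs : ContDiff ℝ ∞ fun x : Plane => η (s⁻¹ • x) := hη.comp (contDiff_const_smul _)
    set ψ : 𝓓(Ω, ℝ) := mulTest (fun x => η (s⁻¹ • x)) hηs φ with hψ
    have hlim : Tendsto (fun x : Plane => s⁻¹ • x) (𝓝 0) (𝓝 0) := by
      simpa using (continuous_const_smul s⁻¹).tendsto (0 : Plane)
    have hsupp : (0 : Plane) ∉ tsupport (φ - ψ : 𝓓(Ω, ℝ)) := by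
      rw [notMem_tsupport_iff_eventuallyEq]
      filter_upwards [hlim.eventually (closedBall_mem_nhds (0 : Plane) η.rIn_pos)] with x hx
      change φ x - η (s⁻¹ • x) * φ x = 0
      rw [η.one_of_mem_closedBall hx]
      ring
    have hTψ : T φ = T ψ := by
      rw [← sub_eq_zero, ← map_sub, ← monoCLM_toPunctured _ hsupp, h0]
    have htψ : tsupport ψ ⊆ closedBall 0 δ := by
      have h2 : tsupport ψ ⊆ tsupport fun x : Plane => η (s⁻¹ • x) := tsupport_mul_subset_left
      refine h2.trans fun x hx => ?_
      have h3 : s⁻¹ • x ∈ tsupport η :=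
        tsupport_comp_subset_preimage η (continuous_const_smul s⁻¹) hx
      rw [η.tsupport_eq, mem_closedBall_zero_iff, norm_smul, norm_inv, Real.norm_of_nonneg hs.le,
        inv_mul_le_iff₀ hs] at h3
      rw [mem_closedBall_zero_iff]
      exact h3.trans (by change s * 1 ≤ δ; linarith)
    have hψg : ⇑ψ = fun x => (fun y : Plane => η y * φ (s • y)) (s⁻¹ • x) := by
      funext x
      change η (s⁻¹ • x) * φ x = _
      simp only [smul_inv_smul₀ hs.ne']
    have hg : ContDiff ℝ ∞ fun y : Plane => η y * φ (s • y) :=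
      hη.mul ((smooth φ).comp (contDiff_const_smul _))
    have hnorm : cNorm m ψ ≤ (m + 1) * (C₁ * A * s) := by
      refine cNorm_le (by positivity) fun i hi x => ?_
      rw [hψg, iteratedFDeriv_comp_const_smul _ (hg.of_le (by exact_mod_cast le_top)), norm_smul,
        norm_pow, norm_inv, Real.norm_of_nonneg hs.le]
      calc s⁻¹ ^ i * _ ≤ s⁻¹ ^ i * (C₁ * s ^ (m + 1) * A) :=
            mul_le_mul_of_nonneg_left (h1 φ (smooth φ) hφ0 A hA s hs hs1 i hi _) (by positivity)
        _ = C₁ * A * (s * s ^ (m - i)) := by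
            obtain ⟨l, rfl⟩ := Nat.exists_eq_add_of_le hi
            rw [Nat.add_sub_cancel_left, inv_pow]
            field_simp
            ring
        _ ≤ C₁ * A * (s * 1) := by
            gcongr
            exact pow_le_one₀ hs.le hs1
        _ = C₁ * A * s := by ring
    calc |T φ| = |T ψ| := by rw [hTψ]
      _ ≤ C * cNorm m ψ := h ψ htψ
      _ ≤ C * ((m + 1) * (C₁ * A * s)) := mul_le_mul_of_nonneg_left hnorm hC
      _ = _ := by ring
  have hlim : Tendsto (fun s : ℝ => C * ((m + 1) * (C₁ * A)) * s) (𝓝[>] 0) (𝓝 0) := by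
    have h2 : Tendsto (fun s : ℝ => C * ((m + 1) * (C₁ * A)) * s) (𝓝 0)
        (𝓝 (C * ((m + 1) * (C₁ * A)) * 0)) := (continuous_const_mul _).tendsto 0
    rw [mul_zero] at h2
    exact h2.mono_left nhdsWithin_le_nhds
  have hle : |T φ| ≤ 0 := ge_of_tendsto hlim (by
    filter_upwards [Ioc_mem_nhdsGT (lt_min one_pos hδ)] with s hs
    exact key s hs.1 (hs.2.trans (min_le_left _ _)) (hs.2.trans (min_le_right _ _)))
  exact abs_nonpos_iff.1 hle

/-! ### Point-supported distributions -/

/-- The distribution sending a test function to the value at the origin of its iterated derivative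
in given directions. -/
noncomputable def pointDeriv (Ω : Opens Plane) {n : ℕ} (w : Fin n → Plane) : 𝓓'(Ω, ℝ) :=
  ofBound
    { toFun := fun φ => iteratedFDeriv ℝ n φ 0 w
      map_add' := fun φ ψ => by
        change iteratedFDeriv ℝ n (⇑φ + ⇑ψ) 0 w = _
        rw [iteratedFDeriv_add_apply ((smooth φ).of_le (by exact_mod_cast le_top)).contDiffAt
          ((smooth ψ).of_le (by exact_mod_cast le_top)).contDiffAt]
        rfl
      map_smul' := fun c φ => by
        change iteratedFDeriv ℝ n (c • ⇑φ) 0 w = _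
        rw [iteratedFDeriv_const_smul_apply
          ((smooth φ).of_le (by exact_mod_cast le_top)).contDiffAt]
        rfl }
    (∏ i, ‖w i‖) n fun φ => by
      rw [mul_comm]
      exact ((iteratedFDeriv ℝ n φ 0).le_opNorm w).trans (mul_le_mul_of_nonneg_right
        (norm_iteratedFDeriv_le_cNorm le_rfl φ 0) (Finset.prod_nonneg fun _ _ => norm_nonneg _))

theorem pointDeriv_apply {Ω : Opens Plane} {n : ℕ} (w : Fin n → Plane) (φ : 𝓓(Ω, ℝ)) :
    pointDeriv Ω w φ = iteratedFDeriv ℝ n φ 0 w := rfl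

theorem pointDeriv_monoCLM {Ω : Opens Plane} {n : ℕ} (w : Fin n → Plane)
    (φ : 𝓓(punctured Ω, ℝ)) : pointDeriv Ω w (TestFunction.monoCLM ℝ φ) = 0 := by
  rw [pointDeriv_apply, coe_monoCLM_test (punctured_le Ω),
    iteratedFDeriv_eq_zero_of_notMem_tsupport (zero_notMem_tsupport_of_punctured φ)]
  rfl

/-- The standard basis of the plane. -/
noncomputable def planeBasis : Module.Basis (Fin 2) ℝ Plane :=
  (EuclideanSpace.basisFun (Fin 2) ℝ).toBasis

theorem planeBasis_apply (i : Fin 2) : planeBasis i = e i := by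
  simp [planeBasis, e]

theorem eq_zero_of_basis {n : ℕ} {L : Plane [×n]→L[ℝ] ℝ}
    (h : ∀ w : Fin n → Fin 2, L (fun k => e (w k)) = 0) : L = 0 := by
  have h1 : L.toMultilinearMap = 0 := Module.Basis.ext_multilinear (fun _ => planeBasis) fun v => by
    simpa [planeBasis_apply] using h v
  ext v
  exact congrArg (fun f => f v) h1

theorem iteratedFDeriv_succ_eq_zero {Ω : Opens Plane} {φ : 𝓓(Ω, ℝ)} {n : ℕ} {x : Plane}
    (h : ∀ i, iteratedFDeriv ℝ n (∂_{e i} φ : 𝓓(Ω, ℝ)) x = 0) :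
    iteratedFDeriv ℝ (n + 1) φ x = 0 := by
  refine eq_zero_of_basis fun w => ?_
  have h1 := congrArg (fun L : Plane [×n]→L[ℝ] ℝ => L (Fin.init fun k => e (w k))) (h (w (Fin.last n)))
  simp only [coe_lineDerivOp_test] at h1
  rw [iteratedFDeriv_clm_apply_const_apply ((smooth φ).fderiv_right (m := ∞) (by simp))
    (by exact_mod_cast le_top)] at h1
  rw [iteratedFDeriv_succ_apply_right]
  exact h1

/-- Beyond value and gradient, a jet is determined by the jets of the second derivatives. This
expresses vanishing of a jet through functionals of the form that Curl Curl can reach. -/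
theorem iteratedFDeriv_eq_zero_of_second {Ω : Opens Plane} {φ : 𝓓(Ω, ℝ)} {m : ℕ} (h0 : φ 0 = 0)
    (h1 : ∀ i, (∂_{e i} φ : 𝓓(Ω, ℝ)) 0 = 0)
    (h2 : ∀ n ≤ m, ∀ (w : Fin n → Fin 2) (i j : Fin 2),
      pointDeriv Ω (fun k => e (w k)) (∂_{e i} (∂_{e j} φ)) = 0) :
    ∀ j ≤ m, iteratedFDeriv ℝ j φ 0 = 0 := by
  intro j hj
  match j, hj with
  | 0, _ =>
    ext v
    simpa using h0
  | 1, _ =>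
    refine iteratedFDeriv_succ_eq_zero fun i => ?_
    ext v
    simpa using h1 i
  | n + 2, hn =>
    exact iteratedFDeriv_succ_eq_zero fun i => iteratedFDeriv_succ_eq_zero fun j =>
      eq_zero_of_basis fun w => h2 n (by lia) w j i

theorem lineDerivOp_eventuallyEq_zero {Ω : Opens Plane} {χ : 𝓓(Ω, ℝ)} {v : Plane}
    (h : (0 : Plane) ∉ tsupport (∂_{v} χ : 𝓓(Ω, ℝ))) :
    ⇑(∂_{v} χ : 𝓓(Ω, ℝ)) =ᶠ[𝓝 0] 0 :=
  notMem_tsupport_iff_eventuallyEq.1 h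

/-- Near the origin χ has zero gradient, so its product with an affine function has no second
derivatives there. -/
theorem pointDeriv_second_mulTest_aff {Ω : Opens Plane} {χ : 𝓓(Ω, ℝ)}
    (hχ : ∀ i, (0 : Plane) ∉ tsupport (∂_{e i} χ : 𝓓(Ω, ℝ))) (a : Fin 2 → ℝ) (c : ℝ) {n : ℕ}
    (w : Fin n → Plane) (i j : Fin 2) :
    pointDeriv Ω w (∂_{e i} (∂_{e j} (mulTest (aff a c) (contDiff_aff a c) χ))) = 0 := by
  have h : ⇑(∂_{e i} (∂_{e j} (mulTest (aff a c) (contDiff_aff a c) χ)) : 𝓓(Ω, ℝ)) =ᶠ[𝓝 0] 0 := by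
    have h3 := lineDerivOp_eventuallyEq_zero
      fun h => hχ j (tsupport_lineDerivOp_subset (∂_{e j} χ) (e i) h)
    filter_upwards [lineDerivOp_eventuallyEq_zero (hχ i), lineDerivOp_eventuallyEq_zero (hχ j), h3]
      with x h1 h2 h3
    rw [lineDerivOp_mulTest_aff, LineDeriv.lineDerivOp_add, LineDeriv.lineDerivOp_smul,
      lineDerivOp_mulTest_aff]
    change aff a c x * (∂_{e i} (∂_{e j} χ) : 𝓓(Ω, ℝ)) x + a i * (∂_{e j} χ : 𝓓(Ω, ℝ)) x +
      a j * (∂_{e i} χ : 𝓓(Ω, ℝ)) x = 0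
    simp [h1, h2, h3]
  rw [pointDeriv_apply, iteratedFDeriv_eq_zero_of_notMem_tsupport
    (notMem_tsupport_iff_eventuallyEq.2 h)]
  rfl

theorem lineDerivOp_test_sub {Ω : Opens Plane} (v : Plane) (φ ψ : 𝓓(Ω, ℝ)) :
    ∂_{v} (φ - ψ) = ∂_{v} φ - ∂_{v} ψ := by
  rw [sub_eq_add_neg, LineDeriv.lineDerivOp_add, LineDeriv.lineDerivOp_neg, ← sub_eq_add_neg]

/-- The evaluation functional of a point-supported distribution on second derivatives is the
incompatibility of a symmetric point-supported tensor. -/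
theorem exists_symm_distCurl_distCurlTensor_eq_second {Ω : Opens Plane} (T : 𝓓'(Ω, ℝ))
    (hT : ∀ φ : 𝓓(punctured Ω, ℝ), T (TestFunction.monoCLM ℝ φ) = 0) (i j : Fin 2) :
    ∃ G : TensorDistribution Ω, G.IsSymm ∧
      (∀ (k l : Fin 2) (φ : 𝓓(punctured Ω, ℝ)), G k l (TestFunction.monoCLM ℝ φ) = 0) ∧
      ∀ φ, distCurl (distCurlTensor G) φ = T (∂_{e i} (∂_{e j} φ)) := by
  have hs (c : ℝ) (φ : 𝓓(Ω, ℝ)) : (c • T) φ = c * T φ := rfl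
  have h0 (φ : 𝓓(Ω, ℝ)) : (0 : 𝓓'(Ω, ℝ)) φ = 0 := rfl
  have hsymm (A B C : 𝓓'(Ω, ℝ)) : (!![A, B; B, C] : TensorDistribution Ω).IsSymm := by
    refine Matrix.IsSymm.ext fun k l => ?_
    fin_cases k <;> fin_cases l <;> rfl
  have hoff : ∃ G : TensorDistribution Ω, G.IsSymm ∧
      (∀ (k l : Fin 2) (φ : 𝓓(punctured Ω, ℝ)), G k l (TestFunction.monoCLM ℝ φ) = 0) ∧
      ∀ φ, distCurl (distCurlTensor G) φ = T (∂_{e 0} (∂_{e 1} φ)) := by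
    -- Both off-diagonal entries enter the incompatibility with a minus sign and the same mixed
    -- derivative, hence -1/2 each.
    refine ⟨!![0, (-1 / 2 : ℝ) • T; (-1 / 2 : ℝ) • T, 0], hsymm _ _ _, fun k l φ => ?_, fun φ => ?_⟩
    · fin_cases k <;> fin_cases l <;> simp [hs, h0, hT]
    · rw [distCurl_distCurlTensor_apply, lineDerivOp_test_comm φ (e 1) (e 0)]
      simp [hs, h0]
      ring
  fin_cases i <;> fin_cases j
  · refine ⟨!![0, 0; 0, T], hsymm _ _ _, fun k l φ => ?_, fun φ => ?_⟩
    · fin_cases k <;> fin_cases l <;> simp [h0, hT]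
    · rw [distCurl_distCurlTensor_apply]
      simp [h0]
  · exact hoff
  · obtain ⟨G, hs, hp, hG⟩ := hoff
    exact ⟨G, hs, hp, fun φ => (hG φ).trans (congrArg T (lineDerivOp_test_comm φ (e 0) (e 1)))⟩
  · refine ⟨!![T, 0; 0, 0], hsymm _ _ _, fun k l φ => ?_, fun φ => ?_⟩
    · fin_cases k <;> fin_cases l <;> simp [h0, hT]
    · rw [distCurl_distCurlTensor_apply]
      simp [h0]

/-- A distribution of finite order supported at the origin which annihilates affine functions is
the incompatibility of a symmetric tensor distribution supported at the origin. -/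
theorem exists_symm_distCurl_distCurlTensor_eq {Ω : Opens Plane} {T : 𝓓'(Ω, ℝ)}
    (hT : FiniteOrderAtZero T)
    (h0 : ∀ φ : 𝓓(punctured Ω, ℝ), T (TestFunction.monoCLM ℝ φ) = 0) {χ : 𝓓(Ω, ℝ)}
    (hχ0 : χ 0 = 1) (hχ : ∀ i, (0 : Plane) ∉ tsupport (∂_{e i} χ : 𝓓(Ω, ℝ)))
    (haff : ∀ a c, T (mulTest (aff a c) (contDiff_aff a c) χ) = 0) :
    ∃ G : TensorDistribution Ω, G.IsSymm ∧
      (∀ (k l : Fin 2) (φ : 𝓓(punctured Ω, ℝ)), G k l (TestFunction.monoCLM ℝ φ) = 0) ∧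
      distCurl (distCurlTensor G) = T := by
  obtain ⟨m, hm⟩ := hT.exists_order h0
  -- Subtracting from φ its first-order Taylor polynomial times χ leaves a function with zero m-jet,
  -- and T annihilates both parts.
  have hker : ∀ φ : 𝓓(Ω, ℝ), (∀ n ≤ m, ∀ (w : Fin n → Fin 2) (i j : Fin 2),
      pointDeriv Ω (fun k => e (w k)) (∂_{e i} (∂_{e j} φ)) = 0) → T φ = 0 := by
    intro φ hφ
    set a : Fin 2 → ℝ := fun i => (∂_{e i} φ : 𝓓(Ω, ℝ)) 0 with ha
    set ℓ := mulTest (aff a (φ 0)) (contDiff_aff a (φ 0)) χ with hℓ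
    have hsub : T (φ - ℓ) = 0 := by
      refine hm _ (iteratedFDeriv_eq_zero_of_second ?_ (fun i => ?_) fun n hn w i j => ?_)
      · change φ 0 - aff a (φ 0) 0 * χ 0 = 0
        simp [aff, hχ0]
      · rw [lineDerivOp_test_sub, hℓ, lineDerivOp_mulTest_aff]
        change (∂_{e i} φ : 𝓓(Ω, ℝ)) 0 -
          (aff a (φ 0) 0 * (∂_{e i} χ : 𝓓(Ω, ℝ)) 0 + a i * χ 0) = 0
        rw [image_eq_zero_of_notMem_tsupport (hχ i), hχ0, ha]
        ring
      · rw [lineDerivOp_test_sub, lineDerivOp_test_sub, map_sub, hφ n hn,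
          pointDeriv_second_mulTest_aff hχ, sub_zero]
    rw [map_sub, haff, sub_zero] at hsub
    exact hsub
  let second (i j : Fin 2) : 𝓓(Ω, ℝ) →ₗ[ℝ] 𝓓(Ω, ℝ) :=
    { toFun := fun φ => ∂_{e i} (∂_{e j} φ)
      map_add' := fun φ ψ => by rw [LineDeriv.lineDerivOp_add, LineDeriv.lineDerivOp_add]
      map_smul' := fun c φ => by
        rw [LineDeriv.lineDerivOp_smul, LineDeriv.lineDerivOp_smul]
        rfl }
  let lin (S : 𝓓'(Ω, ℝ)) : 𝓓(Ω, ℝ) →ₗ[ℝ] ℝ :=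
    { toFun := fun φ => S φ
      map_add' := map_add S
      map_smul' := map_smul S }
  let L (p : Σ n : Fin (m + 1), (Fin n → Fin 2) × Fin 2 × Fin 2) : 𝓓(Ω, ℝ) →ₗ[ℝ] ℝ :=
    lin (pointDeriv Ω fun k => e (p.2.1 k)) ∘ₗ second p.2.2.1 p.2.2.2
  -- The family `L` is finite, so a functional vanishing on the common kernel is a linear
  -- combination of its members.
  have hspan : lin T ∈ Submodule.span ℝ (range L) := by
    refine mem_span_of_iInf_ker_le_ker fun φ hφ => ?_
    rw [Submodule.mem_iInf] at hφ
    exact hker φ fun n hn w i j => hφ ⟨⟨n, Nat.lt_succ_of_le hn⟩, w, i, j⟩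
  have hG : ∀ K ∈ Submodule.span ℝ (range L), ∃ G : TensorDistribution Ω, G.IsSymm ∧
      (∀ (k l : Fin 2) (φ : 𝓓(punctured Ω, ℝ)), G k l (TestFunction.monoCLM ℝ φ) = 0) ∧
      ∀ φ, distCurl (distCurlTensor G) φ = K φ := by
    intro K hK
    induction hK using Submodule.span_induction with
    | mem K hK =>
      obtain ⟨p, rfl⟩ := hK
      exact exists_symm_distCurl_distCurlTensor_eq_second _ (pointDeriv_monoCLM _) _ _
    | zero =>
      refine ⟨0, Matrix.isSymm_zero, fun _ _ _ => rfl, fun φ => ?_⟩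
      have h0 (φ : 𝓓(Ω, ℝ)) : (0 : 𝓓'(Ω, ℝ)) φ = 0 := rfl
      simp [distCurl_distCurlTensor_apply, h0]
    | add K K' _ _ h h' =>
      obtain ⟨G, hs, hp, hG⟩ := h
      obtain ⟨G', hs', hp', hG'⟩ := h'
      refine ⟨G + G', hs.add hs', fun k l φ => ?_, fun φ => ?_⟩
      · change G k l _ + G' k l _ = 0
        rw [hp, hp', add_zero]
      · have ha (i j : Fin 2) (φ : 𝓓(Ω, ℝ)) : (G + G') i j φ = G i j φ + G' i j φ := rfl
        rw [LinearMap.add_apply, ← hG, ← hG']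
        simp only [distCurl_distCurlTensor_apply, ha]
        ring
    | smul c K _ h =>
      obtain ⟨G, hs, hp, hG⟩ := h
      refine ⟨c • G, hs.smul c, fun k l φ => ?_, fun φ => ?_⟩
      · change c * G k l _ = 0
        rw [hp, mul_zero]
      · have ha (i j : Fin 2) (φ : 𝓓(Ω, ℝ)) : (c • G) i j φ = c * G i j φ := rfl
        rw [LinearMap.smul_apply, ← hG]
        simp only [distCurl_distCurlTensor_apply, ha, smul_eq_mul]
        ring
  obtain ⟨G, hs, hp, hG⟩ := hG _ hspan
  refine ⟨G, hs, hp, ?_⟩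
  ext φ
  exact hG φ

/-! ### Extensions of singular strain fields -/

section Extension

variable {Ω : Opens Plane} {F : Plane → Matrix (Fin 2) (Fin 2) ℝ}

theorem IsExtension.restrictTo_distCurl_distCurlTensor {E : TensorDistribution Ω}
    (hF : ∀ i j, ContDiffOn ℝ ∞ (fun x => F x i j) (punctured Ω))
    (hE : IsExtension E (regularTensor (punctured Ω) F)) :
    restrictTo (distCurl (distCurlTensor E)) (punctured Ω) =
      regular (punctured Ω) (curl (curlTensor F)) := by
  have h : (fun i j => restrictTo (E i j) (punctured Ω)) = regularTensor (punctured Ω) F :=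
    funext fun i => funext fun j => hE i j
  rw [SingularStrain.restrictTo_distCurl_distCurlTensor (punctured_le Ω), h,
    distCurl_distCurlTensor_regularTensor hF]

theorem IsExtension.singSupp_subset {E : TensorDistribution Ω}
    (hF : ∀ i j, ContDiffOn ℝ ∞ (fun x => F x i j) (punctured Ω))
    (hE : IsExtension E (regularTensor (punctured Ω) F)) (i j : Fin 2) :
    singSupp (E i j) ⊆ {0} := by
  have h : {x | x ∈ Ω ∧ ¬ IsSmoothAt (E i j) x} ⊆ {0} := fun x hx => by
    by_contra h0
    exact hx.2 ⟨punctured Ω, punctured_le Ω, ⟨hx.1, h0⟩, _, hF i j, hE i j⟩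
  exact inter_subset_right.trans (closure_minimal h isClosed_singleton)

theorem exists_symm_extension (hF : ∀ i j, ContDiffOn ℝ ∞ (fun x => F x i j) (punctured Ω))
    (hsymm : ∀ x ∈ punctured Ω, (F x).IsSymm)
    (hdeg : scalingDegree (regularTensor (punctured Ω) F) < ⊤) :
    ∃ E : TensorDistribution Ω, E.IsSymm ∧ IsExtension E (regularTensor (punctured Ω) F) ∧
      ∀ i j, FiniteOrderAtZero (E i j) := by
  obtain ⟨_, ⟨k, ⟨r, hr0, hr, hs⟩, rfl⟩, _⟩ := sInf_lt_iff.1 hdeg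
  have h (i j : Fin 2) : ∃ T : 𝓓'(Ω, ℝ),
      restrictTo T (punctured Ω) = regular (punctured Ω) (fun x => F x i j) ∧
        FiniteOrderAtZero T := by
    obtain ⟨T, δ, C, m, hδ, hC, hT, hb⟩ :=
      exists_extension_of_scalesToZero (hF i j) hr0 hr (hs i j)
    exact ⟨T, hT, δ, C, m, hδ, hC, hb⟩
  choose T hT hb using h
  have h10 : regular (punctured Ω) (fun x => F x 1 0) = regular (punctured Ω) fun x => F x 0 1 :=
    regular_congr (hF 1 0) fun x hx => (hsymm x hx).apply 0 1
  -- Extensions are not unique, so separate choices for the off-diagonal entries need not agree; one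
  -- choice is used for both.
  refine ⟨!![T 0 0, T 0 1; T 0 1, T 1 1], Matrix.IsSymm.ext fun i j => ?_, fun i j => ?_,
    fun i j => ?_⟩
  · fin_cases i <;> fin_cases j <;> rfl
  · fin_cases i <;> fin_cases j
    · exact hT 0 0
    · exact hT 0 1
    · exact (hT 0 1).trans h10.symm
    · exact hT 1 1
  · fin_cases i <;> fin_cases j
    · exact hb 0 0
    · exact hb 0 1
    · exact hb 0 1
    · exact hb 1 1

/-- The pairing is linear in the affine function, and the functions y_i - x_i with x in the
punctured domain span all affine functions. -/
theorem forall_loopIntegral_eq_zero_iff {E : TensorDistribution Ω}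
    (hF : ∀ i j, ContDiffOn ℝ ∞ (fun x => F x i j) (punctured Ω))
    (hE : IsExtension E (regularTensor (punctured Ω) F))
    (hcurl : ∀ x ∈ punctured Ω, curl (curlTensor F) x = 0) {ε : ℝ} (hε : 0 < ε)
    (hball : closedBall (0 : Plane) ε ⊆ Ω) :
    (∀ x ∈ punctured Ω, loopIntegral ε (cesaroIntegrand F x) = 0) ↔
      ∀ a c, distCurl (distCurlTensor E)
        (mulTest (aff a c) (contDiff_aff a c) (cutoffTest hε hball)) = 0 := by
  have key := distCurl_distCurlTensor_cutoff_aff hF hE hcurl hε hball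
  constructor
  · intro h a c
    set D := distCurl (distCurlTensor E)
    set m : (Fin 2 → ℝ) → ℝ → 𝓓(Ω, ℝ) := fun a c =>
      mulTest (aff a c) (contDiff_aff a c) (cutoffTest hε hball) with hm
    have h0 : ∀ x ∈ punctured Ω, D (m ![0, 1] (-x 1)) = 0 := fun x hx => by
      rw [hm, key, ← loopIntegral_cesaroIntegrand_zero, h x hx]
      rfl
    have h1 : ∀ x ∈ punctured Ω, D (m ![1, 0] (-x 0)) = 0 := fun x hx => by
      rw [hm, key, ← loopIntegral_cesaroIntegrand_one, h x hx]
      simp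
    -- The origin is not an admissible base point. The points ε e₀ and ε e₁ suffice: they give y₁
    -- and y₀ - ε from the first, y₀ from the second, and ε = y₀ - (y₀ - ε) supplies the constants.
    have hmem : ∀ i, ε • e i ∈ punctured Ω := fun i => by
      refine ⟨hball ?_, fun h0 => ?_⟩
      · simp [e, norm_smul, abs_of_pos hε]
      · have := congrArg (fun v : Plane => v i) (mem_singleton_iff.1 h0)
        simp [e, hε.ne'] at this
    have h00 : D (m ![0, 1] 0) = 0 := by simpa [e] using h0 _ (hmem 0)
    have h10 : D (m ![1, 0] (-ε)) = 0 := by simpa [e] using h1 _ (hmem 0)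
    have h11 : D (m ![1, 0] 0) = 0 := by simpa [e] using h1 _ (hmem 1)
    have hlin : m a c = a 0 • m ![1, 0] 0 + a 1 • m ![0, 1] 0 +
        (c / ε) • (m ![1, 0] 0 - m ![1, 0] (-ε)) := by
      ext x
      change aff a c x * _ = a 0 * (aff ![1, 0] 0 x * cutoffTest hε hball x) +
        a 1 * (aff ![0, 1] 0 x * cutoffTest hε hball x) +
        c / ε * (aff ![1, 0] 0 x * cutoffTest hε hball x -
          aff ![1, 0] (-ε) x * cutoffTest hε hball x)
      simp [aff]
      field_simp
      ring
    change D (m a c) = 0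
    rw [hlin, map_add, map_add, map_smul, map_smul, map_smul, map_sub, h00, h10, h11]
    simp
  · intro h x _
    have hc : ∀ a c, circulation ε (cesaroField a c F) = 0 := fun a c => by
      rw [← neg_eq_zero, ← key, h]
    ext i
    fin_cases i
    · exact (loopIntegral_cesaroIntegrand_zero ε F x).trans (by rw [hc, neg_zero]; rfl)
    · exact (loopIntegral_cesaroIntegrand_one ε F x).trans (hc _ _)

theorem exists_compatible_extension_iff
    (hF : ∀ i j, ContDiffOn ℝ ∞ (fun x => F x i j) (punctured Ω))
    (hsymm : ∀ x ∈ punctured Ω, (F x).IsSymm)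
    (hdeg : scalingDegree (regularTensor (punctured Ω) F) < ⊤) {ε : ℝ} (hε : 0 < ε)
    (hball : closedBall (0 : Plane) ε ⊆ Ω) :
    (∃ E ∈ SymA Ω, IsExtension E (regularTensor (punctured Ω) F) ∧
        distCurl (distCurlTensor E) = 0) ↔
      (∀ x ∈ punctured Ω, curl (curlTensor F) x = 0) ∧
      (∀ x ∈ punctured Ω, loopIntegral ε (cesaroIntegrand F x) = 0) := by
  have hcc : ContDiffOn ℝ ∞ (curl (curlTensor F)) (punctured Ω) :=
    contDiffOn_curl (contDiffOn_curlTensor hF)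
  constructor
  · rintro ⟨E, -, hE, h0⟩
    have hcurl : ∀ x ∈ punctured Ω, curl (curlTensor F) x = 0 := by
      refine eq_zero_of_regular_eq_zero hcc ?_
      rw [← hE.restrictTo_distCurl_distCurlTensor hF, h0]
      rfl
    refine ⟨hcurl, (forall_loopIntegral_eq_zero_iff hF hE hcurl hε hball).2
      fun a c => ?_⟩
    rw [h0]
    rfl
  · rintro ⟨hcurl, hloop⟩
    obtain ⟨E, hEs, hE, hEf⟩ := exists_symm_extension hF hsymm hdeg
    have hp (φ : 𝓓(punctured Ω, ℝ)) :
        distCurl (distCurlTensor E) (TestFunction.monoCLM ℝ φ) = 0 := by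
      rw [← restrictTo_apply, hE.restrictTo_distCurl_distCurlTensor hF,
        regular_congr (g := fun _ => 0) hcc hcurl, regular_apply_of_contDiffOn contDiffOn_const]
      simp
    obtain ⟨G, hGs, hGp, hG⟩ := exists_symm_distCurl_distCurlTensor_eq
      (FiniteOrderAtZero.distCurl_distCurlTensor hEf) hp
      ((cutoff_eventuallyEq_one hε).eq_of_nhds)
      (fun i => zero_notMem_tsupport_lineDerivOp_cutoffTest hε hball (e i))
      ((forall_loopIntegral_eq_zero_iff hF hE hcurl hε hball).1 hloop)
    -- The correction G is supported at the origin, so subtracting it leaves the restriction to the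
    -- punctured domain unchanged.
    have hE' : IsExtension (E - G) (regularTensor (punctured Ω) F) := fun i j => by
      rw [← hE i j]
      ext φ
      exact (congrArg (E i j (TestFunction.monoCLM ℝ φ) - ·) (hGp i j φ)).trans (sub_zero _)
    refine ⟨E - G, ⟨hEs.sub hGs, hE'.singSupp_subset hF⟩, hE', ?_⟩
    rw [← sub_eq_zero.2 hG.symm]
    ext φ
    have hs (i j : Fin 2) (φ : 𝓓(Ω, ℝ)) : (E - G) i j φ = E i j φ - G i j φ := rfl
    change _ = distCurl (distCurlTensor E) φ - distCurl (distCurlTensor G) φ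
    simp only [distCurl_distCurlTensor_apply, hs]
    ring

end Extension

end SingularStrain

theorem mainTheorem9
    (Ω : Opens SingularStrain.Plane) (hO : (0 : SingularStrain.Plane) ∈ Ω)
    (hΩ : IsSimplyConnected (Ω : Set SingularStrain.Plane))
    (E₀ : SingularStrain.Plane → Matrix (Fin 2) (Fin 2) ℝ)
    (hsmooth : ∀ i j, ContDiffOn ℝ ∞ (fun x => E₀ x i j) (SingularStrain.punctured Ω))
    (hsymm : ∀ x ∈ SingularStrain.punctured Ω, (E₀ x).IsSymm)
    (hdeg : SingularStrain.scalingDegree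
      (SingularStrain.regularTensor (SingularStrain.punctured Ω) E₀) < ⊤)
    (ε : ℝ) (hε : 0 < ε) (hball : closedBall (0 : SingularStrain.Plane) ε ⊆ Ω) :
    (∃ E ∈ SingularStrain.SymA Ω,
        SingularStrain.IsExtension E
          (SingularStrain.regularTensor (SingularStrain.punctured Ω) E₀) ∧
        SingularStrain.distCurl (SingularStrain.distCurlTensor E) = 0) ↔
      (∀ x ∈ SingularStrain.punctured Ω,
        SingularStrain.curl (SingularStrain.curlTensor E₀) x = 0) ∧
      (∀ x ∈ SingularStrain.punctured Ω,
        SingularStrain.loopIntegral ε (SingularStrain.cesaroIntegrand E₀ x) = 0) := by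
  exact SingularStrain.exists_compatible_extension_iff hsmooth hsymm hdeg hε hball
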